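/- Let $K\subset\mathbb R^n$ be a convex body, i.e. a bounded, open convex set. Let $\psi,\varphi:\mathbb R^n\to\mathbb R$ be $C^\infty$-smooth with $\psi$ convex, $\rho_\psi(x):=\det\nabla^2\psi(x)>0$ for all $x\in\mathbb R^n$, $\inf\varphi>-\infty$ and $\nabla\psi(\mathbb R^n)=K$. Subscripts denote partial derivatives, $(\psi^{ij})$ is the inverse of the matrix $(\psi_{ij})=\nabla^2\psi$, and $\psi_{i\ell}^k=\sum_m\psi^{km}\psi_{i\ell m}$. Let $\psi^*(x)=\sup_{y\in\mathbb R^n}[\langle x,y\rangle-\psi(y)]$ for $x\in K$, so that $\nabla\psi^*:K\to\mathbb R^n$ is the inverse of $\nabla\psi$. For $x\in K$ and $U,V\in\mathbb R^n$ put $$Q^*_{\psi,x}(V)=\sum_{i,j,k,\ell,m,p=1}^n V^iV^j\psi^{\ell m}\psi_{jkm}\psi^{kp}\psi_{i\ell p},\qquad Q_{\psi,x}(U)=\sup\Big\{4\Big(\sum_{i,j=1}^n\psi_{ij}U^iV^j\Big)^2\,;\ V\in\mathbb R^n,\ Q^*_{\psi,x}(V)\le 1\Big\}\in[0,\infty],$$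 where the derivatives of $\psi$ are evaluated at $\nabla\psi^*(x)$. Let $\mu$ be the measure on $\mathbb R^n$ with density $e^{-\varphi}\rho_\psi$ with respect to Lebesgue measure, and write $$\langle\nabla^\psi u,\nabla^\psi h\rangle=\sum_{i,j}\psi^{ij}u_ih_j,\qquad |\nabla^\psi u|^2=\langle\nabla^\psi u,\nabla^\psi u\rangle,\qquad \Delta^\mu u=\sum_{i,j}\psi^{ij}u_{ij}-\sum_{i,j}\psi^{ij}u_i\varphi_j .$$ Assume: ($\star$) for every $x\in\mathbb R^n$ the matrix $\Big(\varphi_{i\ell}-\frac12\sum_k\psi^k_{i\ell}\varphi_k-\frac12\frac{\partial^2\log\rho_\psi}{\partial x_i\partial x_\ell}\Big)_{i,\ell=1,\dots,n}$ is positive semi-definite; and that $(\psi,\varphi)$ is regular at infinity, i.e. there is a linear space $X$ of smooth functions $u:\mathbb R^n\to\mathbb R$ such that (a) for all $u,h\in X$, the functions $h\,\Delta^\mu u$ and $\langle\nabla^\psi u,\nabla^\psi h\rangle$ belong to $L^1(\mu)$ and $\int h\,\Delta^\mu u\,d\mu=-\int\langle\nabla^\psi u,\nabla^\psi h\rangle\,d\mu$;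 the same holds whenever $u\in X$ and $h:\mathbb R^n\to\mathbb R$ is such that $h\circ\nabla\psi^*$ is Lipschitz on $K$; (b) $X$ contains the constant functions, and $u\in X$ implies $\Delta^\mu u\in X$ and $|\nabla^\psi u|^2\in X$; (c) $\{\Delta^\mu u\,;\,u\in X\}$ is dense, in the topology of $L^2(\mu)$, in $\{g\in L^2(\mu)\,;\,\int g\,d\mu=0\}$. Let $\nu$ be the push-forward of $\mu$ under $\nabla\psi$. Then $\nu$ is a finite Borel measure concentrated on $K$, and for any Lipschitz function $f:K\to\mathbb R$, $$\int_K f\,d\nu=0\quad\Longrightarrow\quad\int_K f^2\,d\nu\le\int_K Q_{\psi,x}(\nabla f(x))\,d\nu(x),$$ where the right-hand side may be $+\infty$. -/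

import Mathlib

open MeasureTheory Set
open scoped ENNReal NNReal ContDiff

namespace ToricPoincare

noncomputable section

/-- The partial derivative `∂f/∂xᵢ` of a function on `ℝⁿ`. -/
def pd {n : ℕ} (i : Fin n) (f : EuclideanSpace ℝ (Fin n) → ℝ) :
    EuclideanSpace ℝ (Fin n) → ℝ :=
  fun x => fderiv ℝ f x (EuclideanSpace.single i 1)

/-- The Hessian matrix `(f_{ij})`. -/
def hess {n : ℕ} (f : EuclideanSpace ℝ (Fin n) → ℝ) (x : EuclideanSpace ℝ (Fin n)) :
    Matrix (Fin n) (Fin n) ℝ :=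
  Matrix.of fun i j => pd j (pd i f) x

/-- The third derivatives `f_{ijk}`. -/
def third {n : ℕ} (f : EuclideanSpace ℝ (Fin n) → ℝ) (x : EuclideanSpace ℝ (Fin n))
    (i j k : Fin n) : ℝ :=
  pd k (pd j (pd i f)) x

/-- `ψ^{ij}`: the inverse of the Hessian matrix of `ψ`. -/
def hessInv {n : ℕ} (ψ : EuclideanSpace ℝ (Fin n) → ℝ) (x : EuclideanSpace ℝ (Fin n)) :
    Matrix (Fin n) (Fin n) ℝ :=
  (hess ψ x)⁻¹

/-- `ρ_ψ = det ∇²ψ`. -/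
def rho {n : ℕ} (ψ : EuclideanSpace ℝ (Fin n) → ℝ) (x : EuclideanSpace ℝ (Fin n)) : ℝ :=
  (hess ψ x).det

/-- The Legendre transform `ψ*(x) = sup_y [⟨x, y⟩ - ψ(y)]`. At the points `x = ∇ψ(y)` of a convex
function `ψ`, the only ones where it is used, the supremum is a maximum. -/
def legendre {n : ℕ} (ψ : EuclideanSpace ℝ (Fin n) → ℝ) (x : EuclideanSpace ℝ (Fin n)) : ℝ :=
  ⨆ y : EuclideanSpace ℝ (Fin n), (inner ℝ x y - ψ y)

/-- `Q*_{ψ,x}(V) = ∑ Vⁱ Vʲ ψ^{ℓm} ψ_{jkm} ψ^{kp} ψ_{iℓp}`, the coefficients being evaluated at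
`∇ψ*(x)`. -/
def QStar {n : ℕ} (ψ : EuclideanSpace ℝ (Fin n) → ℝ) (x V : EuclideanSpace ℝ (Fin n)) : ℝ :=
  ∑ i, ∑ j, ∑ k, ∑ l, ∑ m, ∑ p,
    V i * V j * hessInv ψ (gradient (legendre ψ) x) l m * third ψ (gradient (legendre ψ) x) j k m *
      hessInv ψ (gradient (legendre ψ) x) k p * third ψ (gradient (legendre ψ) x) i l p

/-- `Q_{ψ,x}(U) = sup {4 (∑ ψ_{ij} Uⁱ Vʲ)² : Q*_{ψ,x}(V) ≤ 1} ∈ [0, ∞]`, with `ψ_{ij}` evaluated at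
`∇ψ*(x)`. -/
def Q {n : ℕ} (ψ : EuclideanSpace ℝ (Fin n) → ℝ) (x U : EuclideanSpace ℝ (Fin n)) : ℝ≥0∞ :=
  ⨆ (V : EuclideanSpace ℝ (Fin n)) (_ : QStar ψ x V ≤ 1),
    ENNReal.ofReal
      (4 * (∑ i, ∑ j, hess ψ (gradient (legendre ψ) x) i j * U i * V j) ^ 2)

/-- The measure `exp(-φ(x)) ρ_ψ(x) dx` on `ℝⁿ`. (On functions of `x` alone, integration against it
is integration over `ℝⁿ × (ℝ/ℤ)ⁿ` against the product with the Haar probability of the torus.) -/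
def mu {n : ℕ} (ψ φ : EuclideanSpace ℝ (Fin n) → ℝ) : Measure (EuclideanSpace ℝ (Fin n)) :=
  volume.withDensity fun x => ENNReal.ofReal (Real.exp (-φ x) * rho ψ x)

/-- The push-forward of `mu ψ φ` under `∇ψ`. -/
def nu {n : ℕ} (ψ φ : EuclideanSpace ℝ (Fin n) → ℝ) : Measure (EuclideanSpace ℝ (Fin n)) :=
  (mu ψ φ).map (gradient ψ)

/-- `⟨∇^ψ u, ∇^ψ h⟩ = ∑ ψ^{ij} u_i h_j`, the inner product of the Riemannian gradients. -/
def gradInner {n : ℕ} (ψ u h : EuclideanSpace ℝ (Fin n) → ℝ) :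
    EuclideanSpace ℝ (Fin n) → ℝ :=
  fun x => ∑ i, ∑ j, hessInv ψ x i j * pd i u x * pd j h x

/-- `Δ^μ u = ∑ ψ^{ij} u_{ij} - ∑ ψ^{ij} u_i φ_j`. -/
def lap {n : ℕ} (ψ φ u : EuclideanSpace ℝ (Fin n) → ℝ) : EuclideanSpace ℝ (Fin n) → ℝ :=
  fun x => (∑ i, ∑ j, hessInv ψ x i j * hess u x i j) -
    ∑ i, ∑ j, hessInv ψ x i j * pd i u x * pd j φ x

/-- Condition (⋆): for every `x` the matrix
`φ_{iℓ} - ½ ∑_k ψ^k_{iℓ} φ_k - ½ ∂² log ρ_ψ / ∂x_i ∂x_ℓ`, with `ψ^k_{iℓ} = ∑_m ψ^{km} ψ_{iℓm}`,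
is positive semi-definite. -/
def StarCondition {n : ℕ} (ψ φ : EuclideanSpace ℝ (Fin n) → ℝ) : Prop :=
  ∀ x : EuclideanSpace ℝ (Fin n),
    (Matrix.of fun i l : Fin n =>
      hess φ x i l
        - (1 / 2 : ℝ) * ∑ k, (∑ m, hessInv ψ x k m * third ψ x i l m) * pd k φ x
        - (1 / 2 : ℝ) * hess (fun y => Real.log (rho ψ y)) x i l).PosSemidef

/-- `h Δ^μ u` and `⟨∇^ψ u, ∇^ψ h⟩` are `μ`-integrable, and
`∫ h Δ^μ u dμ = -∫ ⟨∇^ψ u, ∇^ψ h⟩ dμ`. -/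
def IntegratesByParts {n : ℕ} (ψ φ u h : EuclideanSpace ℝ (Fin n) → ℝ) : Prop :=
  Integrable (fun x => h x * lap ψ φ u x) (mu ψ φ) ∧
    Integrable (gradInner ψ u h) (mu ψ φ) ∧
    ∫ x, h x * lap ψ φ u x ∂(mu ψ φ) = -∫ x, gradInner ψ u h x ∂(mu ψ φ)

/-- The pair `(ψ, φ)`, where `∇ψ(ℝⁿ) = K`, is regular at infinity. -/
def RegularAtInfinity {n : ℕ} (K : Set (EuclideanSpace ℝ (Fin n)))
    (ψ φ : EuclideanSpace ℝ (Fin n) → ℝ) : Prop :=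
  ∃ X : Submodule ℝ (EuclideanSpace ℝ (Fin n) → ℝ),
    (∀ u ∈ X, ContDiff ℝ ∞ u) ∧
    -- (a)
    (∀ u ∈ X, ∀ h ∈ X, IntegratesByParts ψ φ u h) ∧
    (∀ u ∈ X, ∀ h : EuclideanSpace ℝ (Fin n) → ℝ,
      (∃ C : ℝ≥0, LipschitzOnWith C (fun x => h (gradient (legendre ψ) x)) K) →
        IntegratesByParts ψ φ u h) ∧
    -- (b)
    (∀ c : ℝ, (fun _ => c) ∈ X) ∧
    (∀ u ∈ X, lap ψ φ u ∈ X) ∧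
    (∀ u ∈ X, gradInner ψ u u ∈ X) ∧
    -- (c)
    (∀ g : EuclideanSpace ℝ (Fin n) → ℝ, MemLp g 2 (mu ψ φ) → ∫ x, g x ∂(mu ψ φ) = 0 →
      ∀ ε : ℝ≥0∞, 0 < ε → ∃ u ∈ X, eLpNorm (fun x => lap ψ φ u x - g x) 2 (mu ψ φ) < ε)

end

end ToricPoincare

/-! The proof is Hörmander's $L^2$ duality method for the Hessian metric $\nabla^2\psi$. Put
$V=\nabla^\psi u=(\nabla^2\psi)^{-1}\nabla u$. The Bochner formula (`bochner_identity`) writes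
$\frac12\Delta^\mu|\nabla^\psi u|^2-\langle\nabla^\psi u,\nabla^\psi\Delta^\mu u\rangle$ as a
curvature term, nonnegative by (⋆), plus a square, plus exactly $\frac14Q^*(V)$. Integrating for
$u\in X$ gives $\int Q^*(V)\,d\mu\le4\int(\Delta^\mu u)^2d\mu$ (`integral_qForm_le`).

For $h=f\circ\nabla\psi$ the chain rule turns $\langle\nabla^\psi u,\nabla^\psi h\rangle$ into the
pairing of $\nabla f$ with $V$ that defines $Q$, and $4\langle U,V\rangle-Q^*(V)\le Q(U)$
(`ofReal_sub_qForm_le_Q`). Hence $-4\int h\,\Delta^\mu u\,d\mu-4\int(\Delta^\mu u)^2d\mu\le\int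
Q(\nabla f)\,d\nu$. The left side equals $\int h^2d\mu-4\int(\Delta^\mu u+\frac12h)^2d\mu$, and
density of the range of $\Delta^\mu$ makes the last integral arbitrarily small.

Convexity supplies the transfer between $\mathbb R^n$ and $K$: $\nabla\psi$ is injective with
Jacobian $\rho_\psi$, and $\nabla\psi^*$ inverts it. -/

namespace ToricPoincare

/-! ### Calculus of partial derivatives -/

noncomputable section PartialDerivatives

variable {n : ℕ} {f g : EuclideanSpace ℝ (Fin n) → ℝ}

lemma contDiff_pd (hf : ContDiff ℝ ∞ f) (i : Fin n) : ContDiff ℝ ∞ (pd i f) :=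
  (hf.fderiv_right (m := ∞) le_rfl).clm_apply contDiff_const

lemma contDiff_third (hf : ContDiff ℝ ∞ f) (i j k : Fin n) :
    ContDiff ℝ ∞ (fun x => third f x i j k) :=
  contDiff_pd (contDiff_pd (contDiff_pd hf i) j) k

lemma contDiff_hess (hf : ContDiff ℝ ∞ f) (i j : Fin n) :
    ContDiff ℝ ∞ (fun x => hess f x i j) :=
  contDiff_pd (contDiff_pd hf i) j

lemma pd_comm (hf : ContDiff ℝ ∞ f) (i j : Fin n) : pd i (pd j f) = pd j (pd i f) := by
  funext x
  have hd : DifferentiableAt ℝ (fderiv ℝ f) x :=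
    ((hf.fderiv_right (m := ∞) le_rfl).differentiable (by simp)).differentiableAt
  have key : ∀ a b : Fin n, pd a (pd b f) x =
      fderiv ℝ (fderiv ℝ f) x (EuclideanSpace.single a 1) (EuclideanSpace.single b 1) := by
    intro a b
    change fderiv ℝ (fun y => fderiv ℝ f y (EuclideanSpace.single b 1)) x _ = _
    rw [fderiv_clm_apply hd (differentiableAt_const _)]
    simp
  rw [key, key]
  exact (hf.contDiffAt.isSymmSndFDerivAt (by simp only [minSmoothness_of_isRCLikeNormedField]; exact WithTop.coe_le_coe.2 le_top)).eq _ _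

lemma pd_sub (hf : Differentiable ℝ f) (hg : Differentiable ℝ g) (i : Fin n)
    (x : EuclideanSpace ℝ (Fin n)) :
    pd i (fun y => f y - g y) x = pd i f x - pd i g x := by
  simp only [pd]
  rw [fderiv_fun_sub (hf x) (hg x)]
  rfl

lemma pd_mul (hf : Differentiable ℝ f) (hg : Differentiable ℝ g) (i : Fin n)
    (x : EuclideanSpace ℝ (Fin n)) :
    pd i (fun y => f y * g y) x = pd i f x * g x + f x * pd i g x := by
  simp only [pd]
  rw [fderiv_fun_mul (hf x) (hg x)]
  simp
  ring

lemma pd_const (c : ℝ) (i : Fin n) (x : EuclideanSpace ℝ (Fin n)) :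
    pd i (fun _ => c) x = 0 := by
  simp [pd]

lemma pd_const_mul (hf : Differentiable ℝ f) (c : ℝ) (i : Fin n)
    (x : EuclideanSpace ℝ (Fin n)) :
    pd i (fun y => c * f y) x = c * pd i f x := by
  rw [pd_mul (differentiable_const c) hf, pd_const]
  ring

lemma pd_sum {ι : Type*} {s : Finset ι} {F : ι → EuclideanSpace ℝ (Fin n) → ℝ}
    (hF : ∀ a, Differentiable ℝ (F a)) (i : Fin n) (x : EuclideanSpace ℝ (Fin n)) :
    pd i (fun y => ∑ a ∈ s, F a y) x = ∑ a ∈ s, pd i (F a) x := by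
  simp only [pd]
  rw [fderiv_fun_sum (fun a _ => hF a x)]
  simp

lemma pd_prod {ι : Type*} [DecidableEq ι] {s : Finset ι}
    {F : ι → EuclideanSpace ℝ (Fin n) → ℝ}
    (hF : ∀ a, Differentiable ℝ (F a)) (i : Fin n) (x : EuclideanSpace ℝ (Fin n)) :
    pd i (fun y => ∏ a ∈ s, F a y) x = ∑ a ∈ s, (∏ b ∈ s.erase a, F b x) * pd i (F a) x := by
  simp only [pd]
  rw [fderiv_finsetProd (fun a _ => hF a x)]
  simp

/-- Jacobi's formula: the Leibniz expansion is differentiated one column at a time, and a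
determinant with one column replaced is a Cramer determinant, hence an entry of the adjugate applied
to that column. -/
lemma pd_det {M : EuclideanSpace ℝ (Fin n) → Matrix (Fin n) (Fin n) ℝ}
    (hM : ∀ i j, Differentiable ℝ (fun x => M x i j)) (k : Fin n)
    (x : EuclideanSpace ℝ (Fin n)) :
    pd k (fun y => (M y).det) x =
      ((M x).adjugate * Matrix.of fun i j => pd k (fun y => M y i j) x).trace := by
  have hP : ∀ σ : Equiv.Perm (Fin n), Differentiable ℝ fun y => ∏ a, M y (σ a) a := fun σ y =>
    (HasFDerivAt.finsetProd fun a _ => (hM (σ a) a y).hasFDerivAt).differentiableAt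
  have h1 : pd k (fun y => (M y).det) x =
      ∑ a, ((M x).updateCol a fun i => pd k (fun y => M y i a) x).det := by
    simp only [Matrix.det_apply']
    rw [pd_sum fun σ : Equiv.Perm (Fin n) => (differentiable_const _).fun_mul
      (hP σ)]
    simp_rw [pd_const_mul (hP _),
      pd_prod fun a => hM _ a, Finset.mul_sum]
    rw [Finset.sum_comm]
    refine Finset.sum_congr rfl fun a _ => Finset.sum_congr rfl fun σ _ => ?_
    rw [← Finset.prod_erase_mul _ _ (Finset.mem_univ a)]
    congr 2
    · refine Finset.prod_congr rfl fun b hb => ?_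
      rw [Matrix.updateCol_ne (Finset.ne_of_mem_erase hb)]
    · rw [Matrix.updateCol_self]
  rw [h1, Matrix.trace]
  refine Finset.sum_congr rfl fun a _ => ?_
  rw [← Matrix.cramer_apply, Matrix.cramer_eq_adjugate_mulVec]
  rfl

lemma pd_log (hf : Differentiable ℝ f) (i : Fin n) {x : EuclideanSpace ℝ (Fin n)}
    (hx : f x ≠ 0) : pd i (fun y => Real.log (f y)) x = (f x)⁻¹ * pd i f x := by
  simp only [pd]
  rw [fderiv.log (hf x) hx]
  simp

end PartialDerivatives

/-! ### Derivatives of the inverse Hessian and of its log-determinant -/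

noncomputable section HessianMetric

variable {n : ℕ} {ψ : EuclideanSpace ℝ (Fin n) → ℝ}

lemma hess_symm (hψ : ContDiff ℝ ∞ ψ) (x : EuclideanSpace ℝ (Fin n)) (i j : Fin n) :
    hess ψ x i j = hess ψ x j i :=
  congrFun (pd_comm hψ j i) x

lemma hess_transpose (hψ : ContDiff ℝ ∞ ψ) (x : EuclideanSpace ℝ (Fin n)) :
    (hess ψ x).transpose = hess ψ x :=
  Matrix.ext fun i j => hess_symm hψ x j i

lemma third_swap₁₂ (hψ : ContDiff ℝ ∞ ψ) (x : EuclideanSpace ℝ (Fin n)) (i j k : Fin n) :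
    third ψ x i j k = third ψ x j i k := by
  simp only [third, pd_comm hψ j i]

lemma third_swap₂₃ (hψ : ContDiff ℝ ∞ ψ) (x : EuclideanSpace ℝ (Fin n)) (i j k : Fin n) :
    third ψ x i j k = third ψ x i k j := by
  simp only [third, pd_comm (contDiff_pd hψ i) k j]

lemma hessInv_symm (hψ : ContDiff ℝ ∞ ψ) (x : EuclideanSpace ℝ (Fin n)) (i j : Fin n) :
    hessInv ψ x i j = hessInv ψ x j i := by
  have h : (hessInv ψ x).transpose = hessInv ψ x := by
    rw [hessInv, Matrix.transpose_nonsing_inv, hess_transpose hψ]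
  exact congrFun (congrFun h j) i

lemma contDiff_det {M : EuclideanSpace ℝ (Fin n) → Matrix (Fin n) (Fin n) ℝ}
    (hM : ∀ i j, ContDiff ℝ ∞ (fun x => M x i j)) : ContDiff ℝ ∞ (fun x => (M x).det) := by
  simp only [Matrix.det_apply']
  exact ContDiff.sum fun σ _ => contDiff_const.mul (contDiff_prod fun i _ => hM _ _)

lemma contDiff_rho (hψ : ContDiff ℝ ∞ ψ) : ContDiff ℝ ∞ (rho ψ) :=
  contDiff_det (contDiff_hess hψ)

/-- By Cramer's rule each entry is a polynomial in the second derivatives divided by the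
nonvanishing `rho ψ`. -/
lemma contDiff_hessInv (hψ : ContDiff ℝ ∞ ψ) (hdet : ∀ x, 0 < (hess ψ x).det) (i j : Fin n) :
    ContDiff ℝ ∞ (fun x => hessInv ψ x i j) := by
  have h : (fun x => hessInv ψ x i j) = fun x =>
      (rho ψ x)⁻¹ * ((hess ψ x).transpose.updateCol j (Pi.single i 1)).det := by
    funext x
    rw [hessInv, Matrix.inv_def, Matrix.smul_apply, Ring.inverse_eq_inv', Matrix.adjugate_def]
    simp only [Matrix.of_apply, Matrix.cramer_apply, smul_eq_mul, rho]
  rw [h]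
  refine ((contDiff_rho hψ).inv fun x => (hdet x).ne').mul (contDiff_det fun a b => ?_)
  by_cases hb : b = j
  · subst hb
    simp only [Matrix.updateCol_self]
    exact contDiff_const
  · simp only [Matrix.updateCol_ne hb, Matrix.transpose_apply]
    exact contDiff_hess hψ b a

lemma hessInv_mul_hess (hdet : ∀ x, 0 < (hess ψ x).det) (x : EuclideanSpace ℝ (Fin n)) :
    hessInv ψ x * hess ψ x = 1 :=
  Matrix.nonsing_inv_mul _ (isUnit_iff_ne_zero.2 (hdet x).ne')

lemma hess_mul_hessInv (hdet : ∀ x, 0 < (hess ψ x).det) (x : EuclideanSpace ℝ (Fin n)) :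
    hess ψ x * hessInv ψ x = 1 :=
  Matrix.mul_nonsing_inv _ (isUnit_iff_ne_zero.2 (hdet x).ne')

/-- The matrix `∂_k ∇²ψ`. -/
def dHess (ψ : EuclideanSpace ℝ (Fin n) → ℝ) (k : Fin n) (x : EuclideanSpace ℝ (Fin n)) :
    Matrix (Fin n) (Fin n) ℝ :=
  Matrix.of fun i j => third ψ x i j k

/-- The matrix `∂_l ∂_k ∇²ψ`. -/
def ddHess (ψ : EuclideanSpace ℝ (Fin n) → ℝ) (k l : Fin n) (x : EuclideanSpace ℝ (Fin n)) :
    Matrix (Fin n) (Fin n) ℝ :=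
  Matrix.of fun i j => pd l (fun y => third ψ y i j k) x

/-- `∂_k (ψ^{ij}) = -(A ∂_k∇²ψ A)_{ij}` with `A = (∇²ψ)⁻¹`. -/
lemma pd_hessInv (hψ : ContDiff ℝ ∞ ψ) (hdet : ∀ x, 0 < (hess ψ x).det) (k i j : Fin n)
    (x : EuclideanSpace ℝ (Fin n)) :
    pd k (fun y => hessInv ψ y i j) x = -(hessInv ψ x * dHess ψ k x * hessInv ψ x) i j := by
  set D : Matrix (Fin n) (Fin n) ℝ := Matrix.of fun i j => pd k (fun y => hessInv ψ y i j) x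
  have hA : ∀ i j, Differentiable ℝ (fun y => hessInv ψ y i j) := fun i j =>
    (contDiff_hessInv hψ hdet i j).differentiable (by simp)
  have hg : ∀ i j, Differentiable ℝ (fun y => hess ψ y i j) := fun i j =>
    (contDiff_hess hψ i j).differentiable (by simp)
  -- This is the derivative of the constant product $(\nabla^2\psi)^{-1}\nabla^2\psi=1$.
  have h0 : D * hess ψ x + hessInv ψ x * dHess ψ k x = 0 := by
    ext a b
    have h1 : pd k (fun y => ∑ c, hessInv ψ y a c * hess ψ y c b) x = 0 := by
      have : (fun y => ∑ c, hessInv ψ y a c * hess ψ y c b) =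
          fun _ => (1 : Matrix (Fin n) (Fin n) ℝ) a b := by
        funext y
        rw [← hessInv_mul_hess hdet y, Matrix.mul_apply]
      rw [this, pd_const]
    rw [pd_sum fun c => (hA a c).fun_mul (hg c b)] at h1
    simp_rw [pd_mul (hA _ _) (hg _ _), Finset.sum_add_distrib] at h1
    exact h1
  have h2 : D = -(hessInv ψ x * dHess ψ k x * hessInv ψ x) := by
    have h3 : D * hess ψ x * hessInv ψ x = -(hessInv ψ x * dHess ψ k x) * hessInv ψ x := by
      rw [eq_neg_of_add_eq_zero_left h0]
    rwa [Matrix.mul_assoc, hess_mul_hessInv hdet, Matrix.mul_one, Matrix.neg_mul] at h3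
  exact congrFun (congrFun h2 i) j

lemma pd_log_rho (hψ : ContDiff ℝ ∞ ψ) (hdet : ∀ x, 0 < (hess ψ x).det) (k : Fin n)
    (x : EuclideanSpace ℝ (Fin n)) :
    pd k (fun y => Real.log (rho ψ y)) x = (hessInv ψ x * dHess ψ k x).trace := by
  rw [pd_log ((contDiff_rho hψ).differentiable (by simp)) _ (hdet x).ne']
  have h := pd_det (M := hess ψ) (fun i j => (contDiff_hess hψ i j).differentiable (by simp)) k x
  have h' : pd k (rho ψ) x = ((hess ψ x).adjugate * dHess ψ k x).trace := h
  rw [h', hessInv, Matrix.inv_def, Ring.inverse_eq_inv', Matrix.smul_mul, Matrix.trace_smul]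
  rfl

/-- The Hessian of `log det ∇²ψ`. -/
lemma hess_log_rho (hψ : ContDiff ℝ ∞ ψ) (hdet : ∀ x, 0 < (hess ψ x).det) (k l : Fin n)
    (x : EuclideanSpace ℝ (Fin n)) :
    hess (fun y => Real.log (rho ψ y)) x k l =
      (hessInv ψ x * ddHess ψ k l x).trace -
        (hessInv ψ x * dHess ψ l x * hessInv ψ x * dHess ψ k x).trace := by
  have hA : ∀ i j, Differentiable ℝ (fun y => hessInv ψ y i j) := fun i j =>
    (contDiff_hessInv hψ hdet i j).differentiable (by simp)
  have hT : ∀ i j, Differentiable ℝ (fun y => third ψ y i j k) := fun i j =>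
    (contDiff_third hψ i j k).differentiable (by simp)
  have h1 : pd k (fun y => Real.log (rho ψ y)) =
      fun y => ∑ i, ∑ j, hessInv ψ y i j * third ψ y j i k := by
    funext y
    rw [pd_log_rho hψ hdet]
    simp only [Matrix.trace, Matrix.diag, Matrix.mul_apply, dHess, Matrix.of_apply]
  simp only [hess, Matrix.of_apply]
  rw [h1, pd_sum fun i => Differentiable.fun_sum fun j _ => (hA i j).fun_mul (hT j i)]
  simp_rw [pd_sum fun j => (hA _ j).fun_mul (hT j _), pd_mul (hA _ _) (hT _ _), pd_hessInv hψ hdet]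
  simp only [neg_mul, Finset.sum_add_distrib, Finset.sum_neg_distrib]
  rw [neg_add_eq_sub]
  rfl

end HessianMetric

/-! ### The Bochner identity for the weighted Hessian metric -/

noncomputable section Bochner

open Matrix

variable {n : ℕ} {ψ φ u : EuclideanSpace ℝ (Fin n) → ℝ}

/-- The vector of partial derivatives. -/
def grad (u : EuclideanSpace ℝ (Fin n) → ℝ) (x : EuclideanSpace ℝ (Fin n)) : Fin n → ℝ :=
  fun i => pd i u x

/-- The Riemannian gradient `(∇²ψ)⁻¹ ∇u` with respect to the Hessian metric of `ψ`. -/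
def rgrad (ψ u : EuclideanSpace ℝ (Fin n) → ℝ) (x : EuclideanSpace ℝ (Fin n)) : Fin n → ℝ :=
  hessInv ψ x *ᵥ grad u x

/-- The matrix `∑ₘ ψ_{ijm} Vᵐ`. -/
def dHessAlong (ψ : EuclideanSpace ℝ (Fin n) → ℝ) (V : Fin n → ℝ)
    (x : EuclideanSpace ℝ (Fin n)) : Matrix (Fin n) (Fin n) ℝ :=
  Matrix.of fun i j => ∑ m, third ψ x i j m * V m

lemma hessInv_transpose (hψ : ContDiff ℝ ∞ ψ) (x : EuclideanSpace ℝ (Fin n)) :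
    (hessInv ψ x)ᵀ = hessInv ψ x :=
  Matrix.ext fun i j => hessInv_symm hψ x j i

lemma dHessAlong_transpose (hψ : ContDiff ℝ ∞ ψ) (V : Fin n → ℝ)
    (x : EuclideanSpace ℝ (Fin n)) : (dHessAlong ψ V x)ᵀ = dHessAlong ψ V x := by
  ext i j
  simp only [dHessAlong, Matrix.transpose_apply, Matrix.of_apply, third_swap₁₂ hψ x j i]

lemma gradInner_eq (hψ : ContDiff ℝ ∞ ψ) (u h : EuclideanSpace ℝ (Fin n) → ℝ)
    (x : EuclideanSpace ℝ (Fin n)) : gradInner ψ u h x = rgrad ψ u x ⬝ᵥ grad h x := by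
  simp only [gradInner, rgrad, grad, dotProduct, mulVec]
  rw [Finset.sum_comm]
  refine Finset.sum_congr rfl fun j _ => ?_
  rw [Finset.sum_mul]
  exact Finset.sum_congr rfl fun i _ => by rw [hessInv_symm hψ x i j]

lemma gradInner_comm (hψ : ContDiff ℝ ∞ ψ) (u h : EuclideanSpace ℝ (Fin n) → ℝ)
    (x : EuclideanSpace ℝ (Fin n)) : gradInner ψ u h x = gradInner ψ h u x := by
  simp only [gradInner]
  rw [Finset.sum_comm]
  refine Finset.sum_congr rfl fun j _ => Finset.sum_congr rfl fun i _ => ?_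
  rw [hessInv_symm hψ x i j]
  ring

lemma lap_eq (hψ : ContDiff ℝ ∞ ψ) (hu : ContDiff ℝ ∞ u) (x : EuclideanSpace ℝ (Fin n)) :
    lap ψ φ u x = (hessInv ψ x * hess u x).trace - rgrad ψ φ x ⬝ᵥ grad u x := by
  rw [← gradInner_eq hψ, gradInner_comm hψ, lap, gradInner, Matrix.trace]
  congr 1
  refine Finset.sum_congr rfl fun i _ => ?_
  rw [Matrix.diag_apply, Matrix.mul_apply]
  exact Finset.sum_congr rfl fun j _ => by rw [hess_symm hu x i j]

lemma contDiff_rgrad (hψ : ContDiff ℝ ∞ ψ) (hdet : ∀ x, 0 < (hess ψ x).det)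
    (hu : ContDiff ℝ ∞ u) (i : Fin n) : ContDiff ℝ ∞ (fun x => rgrad ψ u x i) := by
  simp only [rgrad, mulVec, dotProduct]
  exact ContDiff.sum fun j _ => (contDiff_hessInv hψ hdet i j).mul (contDiff_pd hu j)

/-- The Jacobian matrix of the Riemannian gradient. -/
lemma pd_rgrad (hψ : ContDiff ℝ ∞ ψ) (hdet : ∀ x, 0 < (hess ψ x).det)
    (hu : ContDiff ℝ ∞ u) (x : EuclideanSpace ℝ (Fin n)) :
    (Matrix.of fun i l => pd l (fun y => rgrad ψ u y i) x) =
      hessInv ψ x * (hess u x - dHessAlong ψ (rgrad ψ u x) x) := by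
  have hA : ∀ i j, Differentiable ℝ (fun y => hessInv ψ y i j) := fun i j =>
    (contDiff_hessInv hψ hdet i j).differentiable (by simp)
  have hp : ∀ j, Differentiable ℝ (pd j u) := fun j =>
    (contDiff_pd hu j).differentiable (by simp)
  ext i l
  have h1 : pd l (fun y => rgrad ψ u y i) x =
      -((hessInv ψ x * dHess ψ l x * hessInv ψ x) *ᵥ grad u x) i +
        (hessInv ψ x * hess u x) i l := by
    change pd l (fun y => ∑ j, hessInv ψ y i j * pd j u y) x = _
    rw [pd_sum fun j => (hA i j).fun_mul (hp j)]
    simp_rw [pd_mul (hA _ _) (hp _), pd_hessInv hψ hdet, neg_mul]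
    rw [Finset.sum_add_distrib, Finset.sum_neg_distrib]
    rfl
  -- Symmetry of third derivatives: $\partial_l\nabla^2\psi$ applied to $V$ is the $l$-th column of
  -- `dHessAlong ψ V x`.
  have h2 : (hessInv ψ x * dHessAlong ψ (rgrad ψ u x) x) i l =
      ((hessInv ψ x * dHess ψ l x * hessInv ψ x) *ᵥ grad u x) i := by
    rw [← mulVec_mulVec, ← mulVec_mulVec]
    change _ = (hessInv ψ x *ᵥ dHess ψ l x *ᵥ rgrad ψ u x) i
    simp only [Matrix.mul_apply, mulVec, dotProduct, dHessAlong, dHess, Matrix.of_apply,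
      third_swap₂₃ hψ x _ l]
  rw [Matrix.of_apply, h1, Matrix.mul_sub, Matrix.sub_apply, h2]
  ring

lemma gradInner_self_eq_sum (hψ : ContDiff ℝ ∞ ψ) (x : EuclideanSpace ℝ (Fin n)) :
    gradInner ψ u u x = ∑ i, rgrad ψ u x i * pd i u x :=
  gradInner_eq hψ u u x

/-- The differential of `|∇u|²`. -/
lemma grad_gradInner_self (hψ : ContDiff ℝ ∞ ψ) (hdet : ∀ x, 0 < (hess ψ x).det)
    (hu : ContDiff ℝ ∞ u) (x : EuclideanSpace ℝ (Fin n)) :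
    grad (gradInner ψ u u) x =
      (2 : ℝ) • (hess u x *ᵥ rgrad ψ u x) - dHessAlong ψ (rgrad ψ u x) x *ᵥ rgrad ψ u x := by
  have hV : ∀ i, Differentiable ℝ (fun y => rgrad ψ u y i) := fun i =>
    (contDiff_rgrad hψ hdet hu i).differentiable (by simp)
  have hp : ∀ j, Differentiable ℝ (pd j u) := fun j =>
    (contDiff_pd hu j).differentiable (by simp)
  set V := rgrad ψ u x with hVdef
  have h1 : grad (gradInner ψ u u) x =
      grad u x ᵥ* (Matrix.of fun i l => pd l (fun y => rgrad ψ u y i) x) + V ᵥ* hess u x := by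
    ext k
    change pd k (gradInner ψ u u) x = _
    rw [funext (gradInner_self_eq_sum (u := u) hψ), pd_sum fun i => (hV i).fun_mul (hp i)]
    simp_rw [pd_mul (hV _) (hp _), Finset.sum_add_distrib]
    rw [Pi.add_apply]
    congr 1
    exact Finset.sum_congr rfl fun i _ => mul_comm _ _
  have h2 : grad u x ᵥ* hessInv ψ x = V := by
    rw [← mulVec_transpose, hessInv_transpose hψ]; rfl
  rw [h1, pd_rgrad hψ hdet hu, ← vecMul_vecMul, h2, ← mulVec_transpose, ← mulVec_transpose,
    Matrix.transpose_sub, hess_transpose hu, dHessAlong_transpose hψ, sub_mulVec, two_smul]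
  abel

/-- The matrix `∑ᵢⱼ ψ_{klij} Vⁱ Vʲ`. -/
def ddHessAlong (ψ : EuclideanSpace ℝ (Fin n) → ℝ) (V : Fin n → ℝ)
    (x : EuclideanSpace ℝ (Fin n)) : Matrix (Fin n) (Fin n) ℝ :=
  Matrix.of fun k l => ∑ i, ∑ j, pd l (fun y => third ψ y k i j) x * V i * V j

/-- The Hessian matrix of `|∇u|²`. -/
lemma hess_gradInner_self (hψ : ContDiff ℝ ∞ ψ) (hdet : ∀ x, 0 < (hess ψ x).det)
    (hu : ContDiff ℝ ∞ u) (x : EuclideanSpace ℝ (Fin n)) :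
    hess (gradInner ψ u u) x =
      (2 : ℝ) • dHessAlong u (rgrad ψ u x) x - ddHessAlong ψ (rgrad ψ u x) x +
        (2 : ℝ) • ((hess u x - dHessAlong ψ (rgrad ψ u x) x) *
          (hessInv ψ x * (hess u x - dHessAlong ψ (rgrad ψ u x) x))) := by
  have hV : ∀ i, Differentiable ℝ (fun y => rgrad ψ u y i) := fun i =>
    (contDiff_rgrad hψ hdet hu i).differentiable (by simp)
  have hH : ∀ i j, Differentiable ℝ (fun y => hess u y i j) := fun i j =>
    (contDiff_hess hu i j).differentiable (by simp)
  have hT : ∀ i j k, Differentiable ℝ (fun y => third ψ y i j k) := fun i j k =>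
    (contDiff_third hψ i j k).differentiable (by simp)
  rw [← pd_rgrad hψ hdet hu]
  ext k l
  have h1 : pd k (gradInner ψ u u) = fun y => ∑ i, 2 * (hess u y k i * rgrad ψ u y i) -
      ∑ i, ∑ j, third ψ y k i j * (rgrad ψ u y i * rgrad ψ u y j) := by
    funext y
    refine (congrFun (grad_gradInner_self hψ hdet hu y) k).trans ?_
    simp only [Pi.sub_apply, Pi.smul_apply, mulVec, dotProduct, smul_eq_mul, dHessAlong,
      Matrix.of_apply, Finset.sum_mul]
    congr 1
    · exact Finset.mul_sum _ _ _
    · exact Finset.sum_congr rfl fun i _ => Finset.sum_congr rfl fun j _ => by ring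
  change pd l (pd k (gradInner ψ u u)) x = _
  have hHV : ∀ i, Differentiable ℝ (fun y => hess u y k i * rgrad ψ u y i) := fun i =>
    (hH k i).fun_mul (hV i)
  have hTV : ∀ i j, Differentiable ℝ
      (fun y => third ψ y k i j * (rgrad ψ u y i * rgrad ψ u y j)) := fun i j =>
    (hT k i j).fun_mul ((hV i).fun_mul (hV j))
  rw [h1, pd_sub (Differentiable.fun_sum fun i _ => (hHV i).const_mul 2)
    (Differentiable.fun_sum fun i _ => Differentiable.fun_sum fun j _ => hTV i j),
    pd_sum fun i => (hHV i).const_mul 2,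
    pd_sum fun i => Differentiable.fun_sum fun j _ => hTV i j]
  simp_rw [pd_sum (fun j => hTV _ j), pd_const_mul (hHV _), pd_mul (hH _ _) (hV _),
    pd_mul (hT _ _ _) ((hV _).fun_mul (hV _)), pd_mul (hV _) (hV _)]
  set V := rgrad ψ u x
  set D : Matrix (Fin n) (Fin n) ℝ := Matrix.of fun i l => pd l (fun y => rgrad ψ u y i) x
    with hD
  have hDa : ∀ i l, pd l (fun y => rgrad ψ u y i) x = D i l := fun _ _ => rfl
  have hHa : ∀ i, pd l (fun y => hess u y k i) x = third u x k i l := fun _ => rfl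
  -- The two terms from differentiating $V^iV^j$ agree, so the derivatives of $V$ contribute
  -- $2(H-T)D$ in total, with $H$ the Hessian of $u$ and $T$ = `dHessAlong ψ V x`.
  have hTs : ∑ i, ∑ j, third ψ x k i j * (V i * D j l) =
      ∑ i, ∑ j, third ψ x k i j * (D i l * V j) := by
    rw [Finset.sum_comm]
    exact Finset.sum_congr rfl fun i _ => Finset.sum_congr rfl fun j _ => by
      rw [third_swap₂₃ hψ]; ring
  simp only [hDa, hHa, Matrix.add_apply, Matrix.sub_apply, Matrix.smul_apply, smul_eq_mul,
    Matrix.mul_apply, dHessAlong, ddHessAlong, Matrix.of_apply, mul_add, Finset.sum_add_distrib,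
    hTs, sub_mul, Finset.mul_sum, Finset.sum_mul]
  have e1 : ∑ i, 2 * (third u x k i l * V i) = ∑ i, 2 * (third u x k l i * V i) :=
    Finset.sum_congr rfl fun i _ => by rw [third_swap₂₃ hu]
  have e2 : ∑ i, ∑ j, third ψ x k i j * (D i l * V j) =
      ∑ i, ∑ j, third ψ x k i j * V j * D i l :=
    Finset.sum_congr rfl fun i _ => Finset.sum_congr rfl fun j _ => by ring
  rw [e1, e2]
  simp only [mul_assoc, ← Finset.mul_sum]
  ring

/-- The differential of `Δ^μ u` in the direction of the Riemannian gradient of `u`. -/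
lemma gradInner_lap (hψ : ContDiff ℝ ∞ ψ) (hφ : ContDiff ℝ ∞ φ)
    (hdet : ∀ x, 0 < (hess ψ x).det)
    (hu : ContDiff ℝ ∞ u) (x : EuclideanSpace ℝ (Fin n)) :
    gradInner ψ u (lap ψ φ u) x =
      (hessInv ψ x * dHessAlong u (rgrad ψ u x) x).trace -
      (hessInv ψ x * dHessAlong ψ (rgrad ψ u x) x * hessInv ψ x * hess u x).trace -
      rgrad ψ φ x ⬝ᵥ ((hess u x - dHessAlong ψ (rgrad ψ u x) x) *ᵥ rgrad ψ u x) -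
      rgrad ψ u x ⬝ᵥ (hess φ x *ᵥ rgrad ψ u x) := by
  have hA : ∀ i j, Differentiable ℝ (fun y => hessInv ψ y i j) := fun i j =>
    (contDiff_hessInv hψ hdet i j).differentiable (by simp)
  have hV : ∀ i, Differentiable ℝ (fun y => rgrad ψ u y i) := fun i =>
    (contDiff_rgrad hψ hdet hu i).differentiable (by simp)
  have hH : ∀ i j, Differentiable ℝ (fun y => hess u y i j) := fun i j =>
    (contDiff_hess hu i j).differentiable (by simp)
  have hq : ∀ j, Differentiable ℝ (pd j φ) := fun j =>
    (contDiff_pd hφ j).differentiable (by simp)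
  have h1 : lap ψ φ u = fun y => (∑ i, ∑ j, hessInv ψ y i j * hess u y j i) -
      ∑ i, rgrad ψ u y i * pd i φ y := by
    funext y
    rw [lap_eq hψ hu, ← gradInner_eq hψ, gradInner_comm hψ, gradInner_eq hψ]
    rfl
  have h2 : grad (lap ψ φ u) x = fun l =>
      -(hessInv ψ x * dHess ψ l x * hessInv ψ x * hess u x).trace
        + (∑ i, ∑ j, hessInv ψ x i j * third u x j i l) -
        (grad φ x ᵥ* (Matrix.of fun i l => pd l (fun y => rgrad ψ u y i) x)) l -
        (rgrad ψ u x ᵥ* hess φ x) l := by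
    funext l
    change pd l (lap ψ φ u) x = _
    rw [h1, pd_sub (Differentiable.fun_sum fun i _ => Differentiable.fun_sum fun j _ =>
      (hA i j).fun_mul (hH j i)) (Differentiable.fun_sum fun i _ => (hV i).fun_mul (hq i)),
      pd_sum fun i => (hV i).fun_mul (hq i),
      pd_sum fun i => Differentiable.fun_sum fun j _ => (hA i j).fun_mul (hH j i)]
    simp_rw [pd_sum fun j => (hA _ j).fun_mul (hH j _), pd_mul (hA _ _) (hH _ _),
      pd_mul (hV _) (hq _), pd_hessInv hψ hdet, neg_mul, Finset.sum_add_distrib,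
      Finset.sum_neg_distrib]
    rw [← sub_sub]
    congr 2
    exact Finset.sum_congr rfl fun i _ => mul_comm _ _
  set V := rgrad ψ u x with hVdef
  have h3 : grad φ x ᵥ* hessInv ψ x = rgrad ψ φ x := by
    rw [← mulVec_transpose, hessInv_transpose hψ]; rfl
  have e1 : ∑ l, V l * (hessInv ψ x * dHess ψ l x * hessInv ψ x * hess u x).trace =
      (hessInv ψ x * dHessAlong ψ V x * hessInv ψ x * hess u x).trace := by
    have : dHessAlong ψ V x = ∑ l, V l • dHess ψ l x := by
      ext i j
      simp only [dHessAlong, dHess, Matrix.of_apply, Matrix.sum_apply, Matrix.smul_apply,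
        smul_eq_mul, mul_comm]
    simp only [this, Matrix.mul_sum, Matrix.sum_mul, Matrix.trace_sum, Matrix.mul_smul,
      Matrix.smul_mul, Matrix.trace_smul, smul_eq_mul]
  have e2 : ∑ l, V l * ∑ i, ∑ j, hessInv ψ x i j * third u x j i l =
      (hessInv ψ x * dHessAlong u V x).trace := by
    simp only [Matrix.trace, Matrix.diag_apply, Matrix.mul_apply, dHessAlong, Matrix.of_apply,
      Finset.mul_sum]
    rw [Finset.sum_comm]
    refine Finset.sum_congr rfl fun i _ => ?_
    rw [Finset.sum_comm]
    exact Finset.sum_congr rfl fun j _ => Finset.sum_congr rfl fun l _ => by ring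
  rw [gradInner_eq hψ, h2, pd_rgrad hψ hdet hu, ← vecMul_vecMul, h3, ← hVdef]
  have e3 : ∀ (w : Fin n → ℝ) (M : Matrix (Fin n) (Fin n) ℝ),
      ∑ l, V l * (w ᵥ* M) l = w ⬝ᵥ (M *ᵥ V) := by
    intro w M
    rw [dotProduct_mulVec, dotProduct_comm]
    rfl
  rw [← e1, ← e2, ← e3, ← e3]
  simp only [dotProduct, mul_sub, mul_add, mul_neg, Finset.sum_sub_distrib,
    Finset.sum_add_distrib, Finset.sum_neg_distrib]
  ring

/-- Exchanges the free index pair of `ddHessAlong` with the contracted one. The free pair comes out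
reversed, whence the transpose in `hess_log_rho_along`. -/
lemma fourth_symm (hψ : ContDiff ℝ ∞ ψ) (x : EuclideanSpace ℝ (Fin n)) (i j k l : Fin n) :
    pd l (fun y => third ψ y k i j) x = pd j (fun y => third ψ y l k i) x := by
  have h1 : pd l (fun y => third ψ y k i j) = pd j (fun y => third ψ y k i l) :=
    pd_comm (contDiff_pd (contDiff_pd hψ k) i) l j
  rw [h1]
  congr 1
  funext y
  rw [third_swap₂₃ hψ, third_swap₁₂ hψ]

/-- Isolates the fourth-order term of $\log\rho_\psi$ in the form in which it occurs in the Hessian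
of $|\nabla^\psi u|^2$, so that the two match in the Bochner identity. -/
lemma hess_log_rho_along (hψ : ContDiff ℝ ∞ ψ) (hdet : ∀ x, 0 < (hess ψ x).det)
    (V : Fin n → ℝ) (x : EuclideanSpace ℝ (Fin n)) :
    V ⬝ᵥ (hess (fun y => Real.log (rho ψ y)) x *ᵥ V) =
      (hessInv ψ x * ddHessAlong ψ V x).trace -
        (hessInv ψ x * dHessAlong ψ V x * hessInv ψ x * dHessAlong ψ V x).trace := by
  have h1 : dHessAlong ψ V x = ∑ l, V l • dHess ψ l x := by
    ext i j
    simp only [dHessAlong, dHess, Matrix.of_apply, Matrix.sum_apply, Matrix.smul_apply,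
      smul_eq_mul, mul_comm]
  have h2 : (ddHessAlong ψ V x)ᵀ = ∑ k, ∑ l, (V k * V l) • ddHess ψ k l x := by
    ext a b
    simp only [ddHessAlong, ddHess, Matrix.transpose_apply, Matrix.of_apply, Matrix.sum_apply,
      Matrix.smul_apply, smul_eq_mul]
    refine Finset.sum_congr rfl fun i _ => Finset.sum_congr rfl fun j _ => ?_
    rw [fourth_symm hψ]
    ring
  have h3 : (hessInv ψ x * ddHessAlong ψ V x).trace =
      (hessInv ψ x * (ddHessAlong ψ V x)ᵀ).trace := by
    rw [← Matrix.trace_transpose, Matrix.transpose_mul, hessInv_transpose hψ,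
      Matrix.trace_mul_comm]
  rw [h3, h1, h2]
  simp only [dotProduct, mulVec, hess_log_rho hψ hdet, Matrix.sum_mul,
    Matrix.trace_sum, Matrix.mul_smul, Matrix.smul_mul, Matrix.trace_smul, smul_eq_mul,
    sub_mul, mul_sub, Finset.sum_sub_distrib, Finset.mul_sum]
  congr 1
  · exact Finset.sum_congr rfl fun i _ => Finset.sum_congr rfl fun j _ => by ring
  · exact Finset.sum_congr rfl fun i _ => Finset.sum_congr rfl fun j _ => by ring

/-- The curvature form `Ric_μ(V, V)`. -/
def ricci (ψ φ : EuclideanSpace ℝ (Fin n) → ℝ) (V : Fin n → ℝ)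
    (x : EuclideanSpace ℝ (Fin n)) : ℝ :=
  V ⬝ᵥ (hess φ x *ᵥ V) - (1 / 2 : ℝ) * (rgrad ψ φ x ⬝ᵥ (dHessAlong ψ V x *ᵥ V)) -
    (1 / 2 : ℝ) * (V ⬝ᵥ (hess (fun y => Real.log (rho ψ y)) x *ᵥ V))

lemma StarCondition.ricci_nonneg (hψ : ContDiff ℝ ∞ ψ) (h : StarCondition ψ φ) (V : Fin n → ℝ)
    (x : EuclideanSpace ℝ (Fin n)) : 0 ≤ ricci ψ φ V x := by
  have h1 := (h x).dotProduct_mulVec_nonneg V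
  have h2 : rgrad ψ φ x ⬝ᵥ (dHessAlong ψ V x *ᵥ V) =
      ∑ i, ∑ l, V i * ((∑ k, (∑ m, hessInv ψ x k m * third ψ x i l m) * pd k φ x) * V l) := by
    have h3 : ∀ i l, (∑ k, (∑ m, hessInv ψ x k m * third ψ x i l m) * pd k φ x) =
        ∑ m, third ψ x i l m * rgrad ψ φ x m := by
      intro i l
      simp only [rgrad, mulVec, dotProduct, grad, Finset.sum_mul, Finset.mul_sum]
      rw [Finset.sum_comm]
      exact Finset.sum_congr rfl fun m _ => Finset.sum_congr rfl fun k _ => by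
        rw [hessInv_symm hψ x k m]; ring
    simp only [h3]
    simp only [dotProduct, mulVec, dHessAlong, Matrix.of_apply, Finset.sum_mul, Finset.mul_sum]
    refine (Finset.sum_congr rfl fun a _ => Finset.sum_comm).trans (Finset.sum_comm.trans
      (Finset.sum_congr rfl fun i _ => Finset.sum_comm.trans (Finset.sum_congr rfl fun l _ =>
        Finset.sum_congr rfl fun m _ => ?_)))
    rw [third_swap₁₂ hψ x i l m, third_swap₂₃ hψ x l i m, third_swap₁₂ hψ x l m i]
    ring
  -- The first-order coefficient is made opaque so that later distribution of sums leaves it intact.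
  obtain ⟨N, hN⟩ : ∃ N : Fin n → Fin n → ℝ, ∀ i l,
      (∑ k, (∑ m, hessInv ψ x k m * third ψ x i l m) * pd k φ x) = N i l := ⟨_, fun _ _ => rfl⟩
  simp only [hN] at h1 h2
  refine h1.trans_eq ?_
  have h4 : ∀ M : Matrix (Fin n) (Fin n) ℝ, V ⬝ᵥ (M *ᵥ V) = ∑ i, ∑ l, V i * (M i l * V l) :=
    fun M => by simp only [dotProduct, mulVec, Finset.mul_sum]
  rw [ricci, h2, star_trivial, h4, h4, h4]
  simp only [Matrix.of_apply, Finset.mul_sum (a := (1 / 2 : ℝ)), ← Finset.sum_sub_distrib]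
  exact Finset.sum_congr rfl fun i _ => Finset.sum_congr rfl fun j _ => by ring

/-- The Bochner identity for the weighted Kähler metric, in logarithmic coordinates. -/
lemma bochner_identity (hψ : ContDiff ℝ ∞ ψ) (hφ : ContDiff ℝ ∞ φ)
    (hdet : ∀ x, 0 < (hess ψ x).det)
    (hu : ContDiff ℝ ∞ u) (x : EuclideanSpace ℝ (Fin n)) {A H T : Matrix (Fin n) (Fin n) ℝ}
    (hA : A = hessInv ψ x) (hH : H = hess u x) (hT : T = dHessAlong ψ (rgrad ψ u x) x) :
    (1 / 2 : ℝ) * lap ψ φ (gradInner ψ u u) x - gradInner ψ u (lap ψ φ u) x =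
      ricci ψ φ (rgrad ψ u x) x +
        (A * (H - (1 / 2 : ℝ) • T) * A * (H - (1 / 2 : ℝ) • T)).trace +
        (1 / 4 : ℝ) * (A * T * A * T).trace := by
  have hw : ContDiff ℝ ∞ (gradInner ψ u u) := by
    rw [funext (gradInner_self_eq_sum (u := u) hψ)]
    exact ContDiff.sum fun i _ => (contDiff_rgrad hψ hdet hu i).mul (contDiff_pd hu i)
  rw [lap_eq hψ hw, gradInner_lap hψ hφ hdet hu, hess_gradInner_self hψ hdet hu,
    grad_gradInner_self hψ hdet hu, ricci, hess_log_rho_along hψ hdet, ← hA, ← hH, ← hT]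
  -- The third derivatives of $u$ cancel and the fourth derivatives of $\psi$ go into `ricci`,
  -- together with half of $\mathrm{tr}(ATAT)$. What remains is
  -- $\mathrm{tr}(AHAH)-\mathrm{tr}(ATAH)+\frac12\mathrm{tr}(ATAT)$, and completing the square
  -- leaves the constant $\frac14$. Cyclicity of the trace identifies the mixed terms.
  have c1 : (A * H * A * T).trace = (A * T * A * H).trace := by
    rw [Matrix.mul_assoc, Matrix.trace_mul_comm, ← Matrix.mul_assoc]
  simp only [Matrix.mul_add, Matrix.mul_sub, Matrix.sub_mul, Matrix.mul_smul, Matrix.smul_mul,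
    Matrix.trace_add, Matrix.trace_sub, Matrix.trace_smul, smul_eq_mul, dotProduct_sub,
    sub_mulVec, dotProduct_smul, ← Matrix.mul_assoc, c1]
  ring

end Bochner

/-! ### Convexity, the Legendre transform and the gradient map -/

noncomputable section Convexity

open Matrix Filter Topology

variable {n : ℕ} {ψ : EuclideanSpace ℝ (Fin n) → ℝ}

lemma fderiv_eq_sum_pd (f : EuclideanSpace ℝ (Fin n) → ℝ) (x v : EuclideanSpace ℝ (Fin n)) :
    fderiv ℝ f x v = ∑ i, v i * pd i f x := by
  conv_lhs => rw [← (EuclideanSpace.basisFun (Fin n) ℝ).sum_repr v]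
  simp [pd]

lemma gradient_apply (f : EuclideanSpace ℝ (Fin n) → ℝ) (x : EuclideanSpace ℝ (Fin n))
    (i : Fin n) : gradient f x i = pd i f x := by
  have h := inner_gradient_left (𝕜 := ℝ) (f := f) (x := x) (y := EuclideanSpace.single i 1)
  rw [pd, ← h, EuclideanSpace.inner_single_right]
  simp

lemma hasDerivAt_line {f : EuclideanSpace ℝ (Fin n) → ℝ} (hf : Differentiable ℝ f)
    (x v : EuclideanSpace ℝ (Fin n)) (t : ℝ) :
    HasDerivAt (fun s : ℝ => f (x + s • v)) (fderiv ℝ f (x + t • v) v) t := by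
  have h1 : HasDerivAt (fun s : ℝ => x + s • v) v t := by
    simpa using ((hasDerivAt_id t).smul_const v).const_add x
  exact (hf (x + t • v)).hasFDerivAt.comp_hasDerivAt t h1

lemma hasDerivAt_line_fderiv (hψ : ContDiff ℝ ∞ ψ) (x v : EuclideanSpace ℝ (Fin n)) (t : ℝ) :
    HasDerivAt (fun s : ℝ => fderiv ℝ ψ (x + s • v) v)
      (v.ofLp ⬝ᵥ (hess ψ (x + t • v) *ᵥ v.ofLp)) t := by
  simp_rw [fderiv_eq_sum_pd ψ _ v]
  refine (HasDerivAt.fun_sum fun i _ => (hasDerivAt_line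
    ((contDiff_pd hψ i).differentiable (by simp)) x v t).const_mul (v i)).congr_deriv ?_
  refine Finset.sum_congr rfl fun i _ => ?_
  rw [fderiv_eq_sum_pd]
  congr 1
  exact Finset.sum_congr rfl fun j _ => mul_comm _ _

lemma convexOn_line (hconv : ConvexOn ℝ univ ψ) (x v : EuclideanSpace ℝ (Fin n)) :
    ConvexOn ℝ univ (fun s : ℝ => ψ (x + s • v)) := by
  have h := hconv.comp_affineMap (AffineMap.lineMap x (x + v))
  refine (h.congr fun s _ => ?_)
  simp [AffineMap.lineMap_apply, add_comm]

lemma posSemidef_hess (hψ : ContDiff ℝ ∞ ψ) (hconv : ConvexOn ℝ univ ψ)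
    (x : EuclideanSpace ℝ (Fin n)) : (hess ψ x).PosSemidef := by
  refine Matrix.PosSemidef.of_dotProduct_mulVec_nonneg ?_ fun w => ?_
  · rw [Matrix.IsHermitian, Matrix.conjTranspose_eq_transpose_of_trivial, hess_transpose hψ]
  · have hd := hasDerivAt_line (hψ.differentiable (by simp)) x (WithLp.toLp 2 w)
    have h1 := (convexOn_line hconv x (WithLp.toLp 2 w)).monotoneOn_deriv
      fun t _ => (hd t).differentiableAt
    have h2 : deriv (fun s : ℝ => ψ (x + s • WithLp.toLp 2 w)) =
        fun t => fderiv ℝ ψ (x + t • WithLp.toLp 2 w) (WithLp.toLp 2 w) :=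
      funext fun t => (hd t).deriv
    have h3 := h1.derivWithin_nonneg (x := 0)
    rw [derivWithin_univ, h2, (hasDerivAt_line_fderiv hψ x _ 0).deriv] at h3
    simpa using h3

lemma posDef_hess (hψ : ContDiff ℝ ∞ ψ) (hconv : ConvexOn ℝ univ ψ)
    (hdet : ∀ x, 0 < (hess ψ x).det) (x : EuclideanSpace ℝ (Fin n)) : (hess ψ x).PosDef :=
  (posSemidef_hess hψ hconv x).posDef_iff_isUnit.2
    ((Matrix.isUnit_iff_isUnit_det _).2 (isUnit_iff_ne_zero.2 (hdet x).ne'))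

/-- Positive definiteness makes the directional derivative strictly increasing along the segment
from `x` to `y`, so the gradients at its ends differ. -/
lemma gradient_injective (hψ : ContDiff ℝ ∞ ψ) (hconv : ConvexOn ℝ univ ψ)
    (hdet : ∀ x, 0 < (hess ψ x).det) : Function.Injective (gradient ψ) := by
  intro x y hxy
  by_contra hne
  have hv : (y - x).ofLp ≠ 0 := by
    rw [Ne, WithLp.ofLp_eq_zero, sub_eq_zero]
    exact Ne.symm hne
  have h1 : StrictMono fun s : ℝ => fderiv ℝ ψ (x + s • (y - x)) (y - x) :=
    strictMono_of_hasDerivAt_pos (hasDerivAt_line_fderiv hψ x (y - x)) fun t => by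
      simpa using (posDef_hess hψ hconv hdet (x + t • (y - x))).dotProduct_mulVec_pos hv
  have h2 := h1 (zero_lt_one' ℝ)
  simp only [zero_smul, add_zero, one_smul, add_sub_cancel, ← inner_gradient_left, hxy] at h2
  exact lt_irrefl _ h2

lemma tangent_le (hψ : ContDiff ℝ ∞ ψ) (hconv : ConvexOn ℝ univ ψ)
    (y z : EuclideanSpace ℝ (Fin n)) :
    ψ y + inner ℝ (gradient ψ y) (z - y) ≤ ψ z := by
  have h := (convexOn_line hconv y (z - y)).le_slope_of_hasDerivAt (mem_univ 0) (mem_univ 1)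
    one_pos (hasDerivAt_line (hψ.differentiable (by simp)) y (z - y) 0)
  rw [inner_gradient_left]
  simp only [slope_def_field, zero_smul, add_zero, one_smul, add_sub_cancel, sub_zero,
    div_one] at h
  linarith

lemma le_legendre (hψ : ContDiff ℝ ∞ ψ) (hconv : ConvexOn ℝ univ ψ)
    (y z : EuclideanSpace ℝ (Fin n)) :
    inner ℝ (gradient ψ y) z - ψ z ≤ legendre ψ (gradient ψ y) := by
  -- The real supremum is meaningful only for a bounded family; the tangent inequality at `y`
  -- supplies the bound, which is also the value attained there.
  refine le_ciSup (f := fun z => inner ℝ (gradient ψ y) z - ψ z)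
    ⟨inner ℝ (gradient ψ y) y - ψ y, ?_⟩ z
  rintro _ ⟨w, rfl⟩
  have := tangent_le hψ hconv y w
  rw [inner_sub_right] at this
  dsimp only
  linarith

lemma legendre_gradient (hψ : ContDiff ℝ ∞ ψ) (hconv : ConvexOn ℝ univ ψ)
    (y : EuclideanSpace ℝ (Fin n)) :
    legendre ψ (gradient ψ y) = inner ℝ (gradient ψ y) y - ψ y := by
  refine le_antisymm (ciSup_le fun w => ?_) (le_legendre hψ hconv y y)
  have := tangent_le hψ hconv y w
  rw [inner_sub_right] at this
  linarith

lemma contDiff_gradient (hψ : ContDiff ℝ ∞ ψ) : ContDiff ℝ ∞ (gradient ψ) :=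
  (InnerProductSpace.toDual ℝ (EuclideanSpace ℝ (Fin n))).symm.contDiff.comp
    (hψ.fderiv_right (m := ∞) le_rfl)

lemma fderiv_gradient_apply (hψ : ContDiff ℝ ∞ ψ) (y v : EuclideanSpace ℝ (Fin n)) (i : Fin n) :
    fderiv ℝ (gradient ψ) y v i = ∑ j, hess ψ y i j * v j := by
  have h1 : HasFDerivAt (fun z => gradient ψ z i)
      ((EuclideanSpace.proj i).comp (fderiv ℝ (gradient ψ) y)) y :=
    (EuclideanSpace.proj (𝕜 := ℝ) i).hasFDerivAt.comp y
      ((contDiff_gradient hψ).differentiable (by simp) y).hasFDerivAt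
  have h2 : (fun z => gradient ψ z i) = pd i ψ := funext fun z => gradient_apply ψ z i
  rw [h2] at h1
  have h3 := congrArg (fun L => L v) h1.fderiv
  dsimp only at h3
  rw [fderiv_eq_sum_pd] at h3
  exact h3.symm.trans (Finset.sum_congr rfl fun j _ => mul_comm _ _)

lemma det_fderiv_gradient (hψ : ContDiff ℝ ∞ ψ) (y : EuclideanSpace ℝ (Fin n)) :
    (fderiv ℝ (gradient ψ) y).det = rho ψ y := by
  rw [rho, ContinuousLinearMap.det,
    ← LinearMap.det_toMatrix (EuclideanSpace.basisFun (Fin n) ℝ).toBasis]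
  congr 1
  ext i j
  rw [LinearMap.toMatrix_apply]
  simp [fderiv_gradient_apply hψ]

/-- The inverse function theorem, in the filter form that pulls a little-o statement at
$\nabla\psi(y)$ back to `y`. -/
lemma map_gradient_nhds (hψ : ContDiff ℝ ∞ ψ) (hdet : ∀ x, 0 < (hess ψ x).det)
    (y : EuclideanSpace ℝ (Fin n)) : map (gradient ψ) (𝓝 y) = 𝓝 (gradient ψ y) := by
  have hd : (fderiv ℝ (gradient ψ) y).det ≠ 0 := by
    rw [det_fderiv_gradient hψ]
    exact (hdet y).ne'
  have h : HasStrictFDerivAt (gradient ψ)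
      ((ContinuousLinearMap.toContinuousLinearEquivOfDetNeZero _ hd :
        EuclideanSpace ℝ (Fin n) ≃L[ℝ] EuclideanSpace ℝ (Fin n)) :
        EuclideanSpace ℝ (Fin n) →L[ℝ] EuclideanSpace ℝ (Fin n)) y := by
    rw [ContinuousLinearMap.coe_toContinuousLinearEquivOfDetNeZero]
    exact (contDiff_gradient hψ).contDiffAt.hasStrictFDerivAt (by simp)
  exact h.map_nhds_eq_of_equiv

/-- `∇ψ*` inverts `∇ψ`. -/
lemma gradient_legendre (hψ : ContDiff ℝ ∞ ψ) (hconv : ConvexOn ℝ univ ψ)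
    (hdet : ∀ x, 0 < (hess ψ x).det) (y : EuclideanSpace ℝ (Fin n)) :
    gradient (legendre ψ) (gradient ψ y) = y := by
  refine HasGradientAt.gradient (hasGradientAt_iff_isLittleO.2 ?_)
  rw [← map_gradient_nhds hψ hdet y, Asymptotics.isLittleO_map, Asymptotics.isLittleO_iff]
  intro c hc
  filter_upwards [Metric.closedBall_mem_nhds y hc] with z hz
  rw [Metric.mem_closedBall, dist_eq_norm] at hz
  simp only [Function.comp_apply]
  -- The remainder $\psi^*(\nabla\psi(z))-\psi^*(\nabla\psi(y))-\langle
  -- y,\nabla\psi(z)-\nabla\psi(y)\rangle$ lies between $0$ and $\langle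
  -- z-y,\nabla\psi(z)-\nabla\psi(y)\rangle$, and $\|z-y\|\le c$.
  have h1 := le_legendre hψ hconv z y
  have h2 := le_legendre hψ hconv y z
  have h3 := legendre_gradient hψ hconv y
  have h4 := legendre_gradient hψ hconv z
  have h5 := (real_inner_le_norm (z - y) (gradient ψ z - gradient ψ y)).trans
    (mul_le_mul_of_nonneg_right hz (norm_nonneg _))
  rw [inner_sub_left, real_inner_comm, real_inner_comm _ y, inner_sub_left, inner_sub_left] at h5
  rw [Real.norm_eq_abs, abs_le, inner_sub_right, real_inner_comm, real_inner_comm _ y]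
  constructor
  · have : 0 ≤ c * ‖gradient ψ z - gradient ψ y‖ := by positivity
    linarith
  · linarith

lemma measurableEmbedding_gradient (hψ : ContDiff ℝ ∞ ψ) (hconv : ConvexOn ℝ univ ψ)
    (hdet : ∀ x, 0 < (hess ψ x).det) : MeasurableEmbedding (gradient ψ) :=
  (contDiff_gradient hψ).continuous.measurableEmbedding (gradient_injective hψ hconv hdet)

lemma setLIntegral_rho (hψ : ContDiff ℝ ∞ ψ) (hconv : ConvexOn ℝ univ ψ)
    (hdet : ∀ x, 0 < (hess ψ x).det) {s : Set (EuclideanSpace ℝ (Fin n))}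
    (hs : MeasurableSet s) :
    ∫⁻ x in s, ENNReal.ofReal (rho ψ x) = volume (gradient ψ '' s) := by
  rw [← lintegral_abs_det_fderiv_eq_addHaar_image volume hs
    (fun x _ => ((contDiff_gradient hψ).differentiable (by simp)
      x).hasFDerivAt.hasFDerivWithinAt) (gradient_injective hψ hconv hdet).injOn]
  refine lintegral_congr fun x => ?_
  rw [det_fderiv_gradient hψ, abs_of_pos (show 0 < rho ψ x from hdet x)]

lemma isFiniteMeasure_mu {K : Set (EuclideanSpace ℝ (Fin n))} {φ : EuclideanSpace ℝ (Fin n) → ℝ}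
    (hKbdd : Bornology.IsBounded K) (hψ : ContDiff ℝ ∞ ψ) (hconv : ConvexOn ℝ univ ψ)
    (hdet : ∀ x, 0 < (hess ψ x).det) (hφ : BddBelow (range φ))
    (hrange : range (gradient ψ) = K) : IsFiniteMeasure (mu ψ φ) := by
  obtain ⟨m, hm⟩ := hφ
  refine ⟨?_⟩
  rw [mu, withDensity_apply _ MeasurableSet.univ]
  have h1 : ∀ x, ENNReal.ofReal (Real.exp (-φ x) * rho ψ x) ≤
      ENNReal.ofReal (Real.exp (-m)) * ENNReal.ofReal (rho ψ x) := fun x => by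
    rw [← ENNReal.ofReal_mul (Real.exp_pos _).le]
    have := hm (mem_range_self x)
    exact ENNReal.ofReal_le_ofReal (mul_le_mul_of_nonneg_right
      (Real.exp_le_exp.2 (by linarith)) (hdet x).le)
  refine (lintegral_mono h1).trans_lt ?_
  rw [lintegral_const_mul' _ _ ENNReal.ofReal_ne_top, setLIntegral_rho hψ hconv hdet .univ,
    image_univ, hrange]
  exact ENNReal.mul_lt_top ENNReal.ofReal_lt_top hKbdd.measure_lt_top

/-- If `s` is null, change of variables gives $\rho_\psi$ zero integral over the preimage of `s`;
since $\rho_\psi>0$, the preimage is null. This lets Rademacher's theorem be used `nu`-almost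
everywhere. -/
lemma nu_absolutelyContinuous {φ : EuclideanSpace ℝ (Fin n) → ℝ}
    (hψ : ContDiff ℝ ∞ ψ) (hconv : ConvexOn ℝ univ ψ)
    (hdet : ∀ x, 0 < (hess ψ x).det) : nu ψ φ ≪ volume := by
  refine Measure.AbsolutelyContinuous.mk fun s hs h0 => ?_
  have hG := (contDiff_gradient hψ).continuous.measurable
  rw [nu, Measure.map_apply hG hs]
  refine withDensity_absolutelyContinuous _ _ ?_
  have h1 := setLIntegral_rho hψ hconv hdet (hG hs)
  rw [measure_mono_null (image_preimage_subset _ _) h0,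
    lintegral_eq_zero_iff (contDiff_rho hψ).continuous.measurable.ennreal_ofReal] at h1
  have h2 : ∀ᵐ x ∂(volume.restrict (gradient ψ ⁻¹' s)), False :=
    h1.mono fun x hx => absurd hx (ENNReal.ofReal_pos.2 (hdet x)).ne'
  rw [ae_iff] at h2
  simpa using h2

lemma nu_compl {K : Set (EuclideanSpace ℝ (Fin n))} {φ : EuclideanSpace ℝ (Fin n) → ℝ}
    (hKopen : IsOpen K) (hψ : ContDiff ℝ ∞ ψ) (hrange : range (gradient ψ) = K) :
    nu ψ φ Kᶜ = 0 := by
  rw [nu, Measure.map_apply (contDiff_gradient hψ).continuous.measurable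
    hKopen.measurableSet.compl, ← hrange, preimage_compl, preimage_range, compl_univ,
    measure_empty]

open scoped MatrixOrder in
/-- `tr (A B A B) ≥ 0` for `A` positive semi-definite and `B` symmetric. -/
lemma trace_mul_mul_mul_nonneg {A B : Matrix (Fin n) (Fin n) ℝ} (hA : A.PosSemidef)
    (hB : Bᵀ = B) : 0 ≤ (A * B * A * B).trace := by
  have h1 : (B * A * B).PosSemidef := by
    have := hA.mul_mul_conjTranspose_same B
    rwa [Matrix.conjTranspose_eq_transpose_of_trivial, hB] at this
  -- With $A=C^*C$, the trace is that of the positive semi-definite matrix $C(BAB)C^*$.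
  obtain ⟨C, rfl⟩ := CStarAlgebra.nonneg_iff_eq_star_mul_self.mp hA.nonneg
  have h2 := (h1.mul_mul_conjTranspose_same C).trace_nonneg
  rw [← Matrix.star_eq_conjTranspose] at h2
  rw [Matrix.trace_mul_comm, ← Matrix.mul_assoc] at h2
  simpa only [Matrix.mul_assoc] using h2

lemma posSemidef_hessInv (hψ : ContDiff ℝ ∞ ψ) (hconv : ConvexOn ℝ univ ψ)
    (x : EuclideanSpace ℝ (Fin n)) : (hessInv ψ x).PosSemidef :=
  (posSemidef_hess hψ hconv x).inv

/-- The form `Q*` in the coordinate `y = ∇ψ*(x)`. -/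
def qForm (ψ : EuclideanSpace ℝ (Fin n) → ℝ) (V : Fin n → ℝ) (y : EuclideanSpace ℝ (Fin n)) : ℝ :=
  (hessInv ψ y * dHessAlong ψ V y * hessInv ψ y * dHessAlong ψ V y).trace

lemma qForm_nonneg (hψ : ContDiff ℝ ∞ ψ) (hconv : ConvexOn ℝ univ ψ) (V : Fin n → ℝ)
    (y : EuclideanSpace ℝ (Fin n)) : 0 ≤ qForm ψ V y :=
  trace_mul_mul_mul_nonneg (posSemidef_hessInv hψ hconv y) (dHessAlong_transpose hψ V y)

lemma qForm_smul (t : ℝ) (V : Fin n → ℝ) (y : EuclideanSpace ℝ (Fin n)) :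
    qForm ψ (t • V) y = t ^ 2 * qForm ψ V y := by
  have h : dHessAlong ψ (t • V) y = t • dHessAlong ψ V y := by
    ext i j
    simp only [dHessAlong, Matrix.of_apply, Matrix.smul_apply, Pi.smul_apply, smul_eq_mul,
      Finset.mul_sum]
    exact Finset.sum_congr rfl fun m _ => by ring
  simp only [qForm, h, Matrix.mul_smul, Matrix.smul_mul, Matrix.trace_smul, smul_eq_mul]
  ring

lemma QStar_gradient (hψ : ContDiff ℝ ∞ ψ) (hconv : ConvexOn ℝ univ ψ)
    (hdet : ∀ x, 0 < (hess ψ x).det) (y V : EuclideanSpace ℝ (Fin n)) :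
    QStar ψ (gradient ψ y) V = qForm ψ V.ofLp y := by
  have h1 : dHessAlong ψ V.ofLp y = ∑ l, V l • dHess ψ l y := by
    ext i j
    simp only [dHessAlong, dHess, Matrix.of_apply, Matrix.sum_apply, Matrix.smul_apply,
      smul_eq_mul, mul_comm]
  have h2 : ∀ i j, (hessInv ψ y * dHess ψ j y * hessInv ψ y * dHess ψ i y).trace =
      ∑ k, ∑ l, ∑ m, ∑ p, hessInv ψ y l m * third ψ y j k m * hessInv ψ y k p *
        third ψ y i l p := by
    intro i j
    simp only [Matrix.trace, Matrix.diag_apply, Matrix.mul_apply, dHess, Matrix.of_apply,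
      Finset.sum_mul]
    refine (Finset.sum_congr rfl fun l _ => Finset.sum_comm.trans (Finset.sum_congr rfl fun k _ =>
      Finset.sum_comm)).trans (Finset.sum_comm.trans (Finset.sum_congr rfl fun k _ =>
        Finset.sum_congr rfl fun l _ => Finset.sum_congr rfl fun m _ =>
          Finset.sum_congr rfl fun p _ => ?_))
    rw [third_swap₁₂ hψ y m k j, third_swap₂₃ hψ y k m j, third_swap₁₂ hψ y k j m,
      third_swap₂₃ hψ y p l i, third_swap₁₂ hψ y p i l, third_swap₂₃ hψ y i p l]
  simp only [QStar, gradient_legendre hψ hconv hdet, qForm, h1, Matrix.sum_mul, Matrix.mul_sum,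
    Matrix.trace_sum, Matrix.mul_smul, Matrix.smul_mul, Matrix.trace_smul, smul_eq_mul, h2]
  simp only [mul_assoc, ← Finset.mul_sum]

end Convexity

/-! ### The integrated inequality and the duality argument -/

noncomputable section Poincare

open Matrix Filter Topology

variable {n : ℕ} {ψ φ u : EuclideanSpace ℝ (Fin n) → ℝ}

lemma ofReal_integral_le_lintegral {α : Type*} [MeasurableSpace α] {μ : Measure α} {f : α → ℝ}
    (hf : Integrable f μ) : ENNReal.ofReal (∫ x, f x ∂μ) ≤ ∫⁻ x, ENNReal.ofReal (f x) ∂μ := by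
  rw [integral_eq_lintegral_pos_part_sub_lintegral_neg_part hf]
  exact (ENNReal.ofReal_le_ofReal (sub_le_self _ ENNReal.toReal_nonneg)).trans
    ENNReal.ofReal_toReal_le

lemma continuous_qForm_rgrad (hψ : ContDiff ℝ ∞ ψ) (hdet : ∀ x, 0 < (hess ψ x).det)
    (hu : ContDiff ℝ ∞ u) : Continuous fun x => qForm ψ (rgrad ψ u x) x := by
  have hA : Continuous fun x => hessInv ψ x := continuous_matrix fun i j =>
    (contDiff_hessInv hψ hdet i j).continuous
  have hT : Continuous fun x => dHessAlong ψ (rgrad ψ u x) x := continuous_matrix fun i j => by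
    simp only [dHessAlong, Matrix.of_apply]
    exact continuous_finsetSum _ fun m _ => (contDiff_third hψ i j m).continuous.mul
      (contDiff_rgrad hψ hdet hu m).continuous
  exact (((hA.mul hT).mul hA).mul hT).matrix_trace

/-- The curvature and square terms of the Bochner identity are nonnegative and are dropped;
multiplying by 4 clears the remaining $\frac14$. -/
lemma qForm_le_bochner (hψ : ContDiff ℝ ∞ ψ) (hφ : ContDiff ℝ ∞ φ) (hconv : ConvexOn ℝ univ ψ)
    (hdet : ∀ x, 0 < (hess ψ x).det) (hstar : StarCondition ψ φ)
    (hu : ContDiff ℝ ∞ u) (x : EuclideanSpace ℝ (Fin n)) :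
    qForm ψ (rgrad ψ u x) x ≤
      2 * lap ψ φ (gradInner ψ u u) x - 4 * gradInner ψ u (lap ψ φ u) x := by
  have h1 := bochner_identity hψ hφ hdet hu x rfl rfl rfl
  have h2 := hstar.ricci_nonneg hψ (rgrad ψ u x) x
  have h3 := trace_mul_mul_mul_nonneg (posSemidef_hessInv hψ hconv x)
    (B := hess u x - (1 / 2 : ℝ) • dHessAlong ψ (rgrad ψ u x) x)
    (by rw [Matrix.transpose_sub, Matrix.transpose_smul, hess_transpose hu,
      dHessAlong_transpose hψ])
  rw [qForm]
  linarith

/-- The integrated Bochner inequality. -/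
lemma integral_qForm_le (hψ : ContDiff ℝ ∞ ψ) (hφ : ContDiff ℝ ∞ φ) (hconv : ConvexOn ℝ univ ψ)
    (hdet : ∀ x, 0 < (hess ψ x).det) (hstar : StarCondition ψ φ)
    (hu : ContDiff ℝ ∞ u) (h1 : IntegratesByParts ψ φ (gradInner ψ u u) fun _ => 1)
    (h2 : IntegratesByParts ψ φ u (lap ψ φ u)) :
    Integrable (fun x => qForm ψ (rgrad ψ u x) x) (mu ψ φ) ∧
      ∫ x, qForm ψ (rgrad ψ u x) x ∂(mu ψ φ) ≤ 4 * ∫ x, lap ψ φ u x ^ 2 ∂(mu ψ φ) := by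
  obtain ⟨h1a, -, h1c⟩ := h1
  obtain ⟨-, h2b, h2c⟩ := h2
  -- Testing against the constant 1 gives $\int\Delta^\mu|\nabla^\psi u|^2d\mu=0$.
  have h0 : ∀ x, gradInner ψ (gradInner ψ u u) (fun _ => 1) x = 0 := fun x => by
    simp [gradInner, pd_const]
  simp only [one_mul, h0, integral_zero, neg_zero] at h1a h1c
  have hb : Integrable (fun x => 2 * lap ψ φ (gradInner ψ u u) x -
      4 * gradInner ψ u (lap ψ φ u) x) (mu ψ φ) := (h1a.const_mul 2).sub (h2b.const_mul 4)
  -- Integrability comes from the pointwise Bochner bound itself, as the form is nonnegative.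
  have hq : Integrable (fun x => qForm ψ (rgrad ψ u x) x) (mu ψ φ) :=
    hb.mono' (continuous_qForm_rgrad hψ hdet hu).aestronglyMeasurable (ae_of_all _ fun x => by
      rw [Real.norm_eq_abs, abs_of_nonneg (qForm_nonneg hψ hconv _ x)]
      exact qForm_le_bochner hψ hφ hconv hdet hstar hu x)
  refine ⟨hq, (integral_mono hq hb fun x =>
    qForm_le_bochner hψ hφ hconv hdet hstar hu x).trans_eq ?_⟩
  rw [integral_sub (h1a.const_mul 2) (h2b.const_mul 4), integral_const_mul, integral_const_mul,
    h1c]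
  simp only [pow_two]
  linarith

/-- The Legendre-type inequality `4 ⟨U, V⟩ - Q*(V) ≤ Q(U)`. -/
lemma ofReal_sub_qForm_le_Q (hψ : ContDiff ℝ ∞ ψ) (hconv : ConvexOn ℝ univ ψ)
    (hdet : ∀ x, 0 < (hess ψ x).det) (y U : EuclideanSpace ℝ (Fin n)) (V : Fin n → ℝ) :
    ENNReal.ofReal (4 * (∑ i, ∑ j, hess ψ y i j * U i * V j) - qForm ψ V y) ≤
      Q ψ (gradient ψ y) U := by
  set a := ∑ i, ∑ j, hess ψ y i j * U i * V j with ha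
  set q := qForm ψ V y with hq
  have hq0 : 0 ≤ q := qForm_nonneg hψ hconv V y
  rcases le_or_gt (4 * a - q) 0 with h | h
  · rw [ENNReal.ofReal_of_nonpos h]
    exact zero_le
  have ha0 : 0 < a := by linarith
  -- For $q>0$, normalizing $V$ by $\sqrt q$ gives the value $4a^2/q\ge4a-q$, which is
  -- $(2a-q)^2\ge0$. For $q=0$ every multiple of $V$ is admissible, and $t=a^{-1/2}$ yields exactly
  -- $4a$.
  obtain ⟨t, ht1, ht2⟩ : ∃ t : ℝ, t ^ 2 * q ≤ 1 ∧ 4 * a - q ≤ 4 * (t * a) ^ 2 := by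
    rcases hq0.eq_or_lt with h0 | h0
    · refine ⟨(√a)⁻¹, by simp [← h0], ?_⟩
      rw [mul_pow, inv_pow, Real.sq_sqrt ha0.le, ← h0, pow_two, inv_mul_cancel_left₀ ha0.ne']
      linarith
    · refine ⟨(√q)⁻¹, ?_, ?_⟩
      · rw [inv_pow, Real.sq_sqrt h0.le, inv_mul_cancel₀ h0.ne']
      · rw [mul_pow, inv_pow, Real.sq_sqrt h0.le, inv_mul_eq_div, mul_div_assoc',
          le_div_iff₀ h0]
        nlinarith [sq_nonneg (2 * a - q)]
  have hs : ∑ i, ∑ j, hess ψ y i j * U i * (t * V j) = t * a := by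
    simp only [ha, Finset.mul_sum]
    exact Finset.sum_congr rfl fun i _ => Finset.sum_congr rfl fun j _ => by ring
  have h1 : QStar ψ (gradient ψ y) (WithLp.toLp 2 (t • V)) ≤ 1 := by
    rw [QStar_gradient hψ hconv hdet]
    exact (qForm_smul t V y).trans_le ht1
  refine (ENNReal.ofReal_le_ofReal ht2).trans ?_
  rw [← hs]
  refine le_trans (le_of_eq ?_) (le_iSup₂ (WithLp.toLp 2 (t • V)) h1)
  rw [gradient_legendre hψ hconv hdet]
  rfl

lemma gradInner_comp_gradient (hψ : ContDiff ℝ ∞ ψ) {f : EuclideanSpace ℝ (Fin n) → ℝ}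
    (u : EuclideanSpace ℝ (Fin n) → ℝ) {y : EuclideanSpace ℝ (Fin n)}
    (hf : DifferentiableAt ℝ f (gradient ψ y)) :
    gradInner ψ u (fun x => f (gradient ψ x)) y =
      ∑ i, ∑ j, hess ψ y i j * gradient f (gradient ψ y) i * rgrad ψ u y j := by
  have h1 : ∀ j, pd j (fun x => f (gradient ψ x)) y =
      ∑ i, hess ψ y i j * gradient f (gradient ψ y) i := by
    intro j
    have h2 := hf.hasFDerivAt.comp y
      ((contDiff_gradient hψ).differentiable (by simp) y).hasFDerivAt
    have h3 : pd j (fun x => f (gradient ψ x)) y =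
        fderiv ℝ f (gradient ψ y) (fderiv ℝ (gradient ψ) y (EuclideanSpace.single j 1)) :=
      congrArg (fun L => L (EuclideanSpace.single j 1)) h2.fderiv
    rw [h3, fderiv_eq_sum_pd]
    refine Finset.sum_congr rfl fun i _ => ?_
    rw [fderiv_gradient_apply hψ, gradient_apply]
    simp
  rw [gradInner_eq hψ, Finset.sum_comm]
  refine Finset.sum_congr rfl fun j _ => ?_
  rw [← Finset.sum_mul, ← h1, mul_comm]
  rfl

/-- Rademacher's theorem on `K`, transported by absolute continuity of `nu`; openness of `K`
upgrades differentiability within `K` to full differentiability. -/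
lemma ae_differentiableAt_gradient {K : Set (EuclideanSpace ℝ (Fin n))}
    {f : EuclideanSpace ℝ (Fin n) → ℝ} {C : ℝ≥0}
    (hKopen : IsOpen K) (hψ : ContDiff ℝ ∞ ψ) (hconv : ConvexOn ℝ univ ψ)
    (hdet : ∀ x, 0 < (hess ψ x).det) (hrange : range (gradient ψ) = K)
    (hf : LipschitzOnWith C f K) :
    ∀ᵐ y ∂(mu ψ φ), DifferentiableAt ℝ f (gradient ψ y) := by
  have h1 : ∀ᵐ x ∂(nu ψ φ), x ∈ K → DifferentiableWithinAt ℝ f K x :=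
    (nu_absolutelyContinuous hψ hconv hdet).ae_le hf.ae_differentiableWithinAt_of_mem
  filter_upwards [ae_of_ae_map (contDiff_gradient hψ).continuous.aemeasurable h1] with y hy
  have hyK : gradient ψ y ∈ K := hrange ▸ mem_range_self y
  exact (hy hyK).differentiableAt (hKopen.mem_nhds hyK)

/-- The weak form of the dual inequality, for one test function `u`. -/
lemma ofReal_integral_le_lintegral_Q {K : Set (EuclideanSpace ℝ (Fin n))}
    {f : EuclideanSpace ℝ (Fin n) → ℝ} {C : ℝ≥0}
    (hKopen : IsOpen K) (hψ : ContDiff ℝ ∞ ψ) (hφ : ContDiff ℝ ∞ φ) (hconv : ConvexOn ℝ univ ψ)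
    (hdet : ∀ x, 0 < (hess ψ x).det) (hstar : StarCondition ψ φ)
    (hrange : range (gradient ψ) = K) (hf : LipschitzOnWith C f K)
    (hu : ContDiff ℝ ∞ u) (h1 : IntegratesByParts ψ φ (gradInner ψ u u) fun _ => 1)
    (h2 : IntegratesByParts ψ φ u (lap ψ φ u))
    (h3 : IntegratesByParts ψ φ u fun x => f (gradient ψ x)) :
    ENNReal.ofReal (-4 * (∫ x, f (gradient ψ x) * lap ψ φ u x ∂(mu ψ φ)) -
        4 * ∫ x, lap ψ φ u x ^ 2 ∂(mu ψ φ)) ≤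
      ∫⁻ x, Q ψ x (gradient f x) ∂(nu ψ φ) := by
  obtain ⟨hq, hqle⟩ := integral_qForm_le hψ hφ hconv hdet hstar hu h1 h2
  obtain ⟨-, h3b, h3c⟩ := h3
  -- Since $\nabla\psi$ is a measurable embedding, no measurability of `Q` is needed here.
  rw [nu, (measurableEmbedding_gradient hψ hconv hdet).lintegral_map]
  have hle : -4 * (∫ x, f (gradient ψ x) * lap ψ φ u x ∂(mu ψ φ)) -
        4 * ∫ x, lap ψ φ u x ^ 2 ∂(mu ψ φ) ≤
      ∫ x, (4 * gradInner ψ u (fun x => f (gradient ψ x)) x - qForm ψ (rgrad ψ u x) x)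
        ∂(mu ψ φ) := by
    rw [integral_sub (h3b.const_mul 4) hq, integral_const_mul, h3c]
    linarith
  refine (ENNReal.ofReal_le_ofReal hle).trans
    ((ofReal_integral_le_lintegral ((h3b.const_mul 4).sub hq)).trans (lintegral_mono_ae ?_))
  filter_upwards [ae_differentiableAt_gradient (φ := φ) hKopen hψ hconv hdet hrange hf] with y hy
  simp only [Pi.sub_apply]
  rw [gradInner_comp_gradient hψ u hy]
  exact ofReal_sub_qForm_le_Q hψ hconv hdet y _ _

/-- The Poincaré-type inequality `∫ f² dν ≤ ∫ Q(∇f) dν` for centred Lipschitz functions. -/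
theorem lintegral_sq_le_lintegral_Q {K : Set (EuclideanSpace ℝ (Fin n))}
    {f : EuclideanSpace ℝ (Fin n) → ℝ} {C : ℝ≥0}
    (hKopen : IsOpen K) (hKbdd : Bornology.IsBounded K)
    (hψ : ContDiff ℝ ∞ ψ) (hφ : ContDiff ℝ ∞ φ) (hψconv : ConvexOn ℝ univ ψ)
    (hdet : ∀ x, 0 < (hess ψ x).det) (hφbdd : BddBelow (range φ))
    (hrange : range (gradient ψ) = K) (hstar : StarCondition ψ φ)
    (hreg : RegularAtInfinity K ψ φ) (hf : LipschitzOnWith C f K)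
    (hf0 : ∫ x in K, f x ∂(nu ψ φ) = 0) :
    ∫⁻ x in K, ENNReal.ofReal (f x ^ 2) ∂(nu ψ φ) ≤
      ∫⁻ x in K, Q ψ x (gradient f x) ∂(nu ψ φ) := by
  have hfin : IsFiniteMeasure (mu ψ φ) := isFiniteMeasure_mu hKbdd hψ hψconv hdet hφbdd hrange
  have hemb := measurableEmbedding_gradient hψ hψconv hdet
  have hrestrict : (nu ψ φ).restrict K = nu ψ φ :=
    Measure.restrict_eq_self_of_ae_mem (mem_ae_iff.2 (nu_compl hKopen hψ hrange))
  rw [hrestrict] at hf0 ⊢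
  obtain ⟨X, hXs, hXX, hXL, hXc, hXlap, hXgrad, hXd⟩ := hreg
  set h : EuclideanSpace ℝ (Fin n) → ℝ := fun x => f (gradient ψ x) with hh
  have hmem : ∀ x, gradient ψ x ∈ K := fun x => hrange ▸ mem_range_self x
  have hLip : LipschitzOnWith C (fun x => h (gradient (legendre ψ) x)) K := by
    have hfeq : EqOn f (fun x => h (gradient (legendre ψ) x)) K := by
      rw [← hrange]
      rintro _ ⟨y, rfl⟩
      simp only [hh, gradient_legendre hψ hψconv hdet]
    intro x hx y hy
    rw [← hfeq hx, ← hfeq hy]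
    exact hf hx hy
  have hcont : Continuous h :=
    hf.continuousOn.comp_continuous (contDiff_gradient hψ).continuous hmem
  -- A Lipschitz function on the bounded set `K` is bounded, so `h` lies in $L^2$ of the finite
  -- measure `mu`.
  have hbound : ∀ x, ‖h x‖ ≤ ‖h 0‖ + C * Metric.diam K := fun x => by
    have h1 := hf.dist_le_mul _ (hmem x) _ (hmem 0)
    have h2 := mul_le_mul_of_nonneg_left
      (Metric.dist_le_diam_of_mem hKbdd (hmem x) (hmem 0)) C.coe_nonneg
    rw [dist_eq_norm] at h1
    have h3 : ‖h x‖ ≤ ‖h 0‖ + ‖h x - h 0‖ := norm_le_norm_add_norm_sub' _ _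
    exact h3.trans (by gcongr; exact h1.trans h2)
  have hmemLp : MemLp h 2 (mu ψ φ) := MemLp.of_bound hcont.aestronglyMeasurable _
    (ae_of_all _ hbound)
  have hint : ∫ x, h x ∂(mu ψ φ) = 0 := by
    rw [nu, hemb.integral_map] at hf0
    exact hf0
  have hsq : Integrable (fun x => h x ^ 2) (mu ψ φ) := hmemLp.integrable_sq
  have hLHS : ∫⁻ x, ENNReal.ofReal (f x ^ 2) ∂(nu ψ φ) =
      ENNReal.ofReal (∫ x, h x ^ 2 ∂(mu ψ φ)) := by
    rw [nu, hemb.lintegral_map, ofReal_integral_eq_lintegral_ofReal hsq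
      (ae_of_all _ fun x => sq_nonneg _)]
  rw [hLHS]
  refine ENNReal.le_of_forall_pos_le_add fun δ hδ _ => ?_
  have hδ' : (0 : ℝ) < √(δ / 4) := Real.sqrt_pos.2 (by positivity)
  -- The target $-\frac12h$ maximizes $-4\int hg\,d\mu-4\int g^2d\mu$ over $g$. A squared $L^2$
  -- error of $\delta/4$ costs at most $\delta$, because the deficit is four times that error.
  obtain ⟨u, huX, hu⟩ := hXd (fun x => (-1 / 2 : ℝ) * h x) (hmemLp.const_mul _)
    (by rw [integral_const_mul, hint, mul_zero]) (ENNReal.ofReal √(δ / 4))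
    (ENNReal.ofReal_pos.2 hδ')
  have hlapX := hXlap u huX
  have hlapsq : Integrable (fun x => lap ψ φ u x ^ 2) (mu ψ φ) := by
    simpa only [pow_two] using (hXX u huX _ hlapX).1
  have hlapLp : MemLp (lap ψ φ u) 2 (mu ψ φ) :=
    (memLp_two_iff_integrable_sq (hXs _ hlapX).continuous.aestronglyMeasurable).2 hlapsq
  have heLp : MemLp (fun x => lap ψ φ u x - (-1 / 2 : ℝ) * h x) 2 (mu ψ φ) :=
    hlapLp.sub (hmemLp.const_mul _)
  have he : ∫ x, (lap ψ φ u x - (-1 / 2 : ℝ) * h x) ^ 2 ∂(mu ψ φ) ≤ δ / 4 := by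
    rw [heLp.eLpNorm_eq_integral_rpow_norm (by simp) (by simp),
      ENNReal.ofReal_lt_ofReal_iff hδ'] at hu
    simp only [ENNReal.toReal_ofNat, Real.rpow_two, Real.norm_eq_abs, sq_abs] at hu
    rw [← one_div, ← Real.sqrt_eq_rpow] at hu
    exact (Real.sqrt_lt_sqrt_iff (integral_nonneg fun x => sq_nonneg _)).1 hu |>.le
  have hmain := ofReal_integral_le_lintegral_Q hKopen hψ hφ hψconv hdet hstar hrange hf
    (hXs u huX) (hXX _ (hXgrad u huX) _ (hXc 1)) (hXX u huX _ hlapX) (hXL u huX h ⟨C, hLip⟩)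
  have hprod : Integrable (fun x => h x * lap ψ φ u x) (mu ψ φ) := (hXL u huX h ⟨C, hLip⟩).1
  have hsum : Integrable (fun x => lap ψ φ u x ^ 2 + h x * lap ψ φ u x) (mu ψ φ) :=
    hlapsq.add hprod
  have hexp : ∫ x, (lap ψ φ u x - (-1 / 2 : ℝ) * h x) ^ 2 ∂(mu ψ φ) =
      ∫ x, lap ψ φ u x ^ 2 ∂(mu ψ φ) + ∫ x, h x * lap ψ φ u x ∂(mu ψ φ) +
        1 / 4 * ∫ x, h x ^ 2 ∂(mu ψ φ) := by
    rw [← integral_const_mul, ← integral_add hlapsq hprod,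
      ← integral_add hsum (hsq.const_mul _)]
    exact integral_congr_ae (ae_of_all _ fun x => by dsimp only; ring)
  calc ENNReal.ofReal (∫ x, h x ^ 2 ∂(mu ψ φ))
      ≤ ENNReal.ofReal ((-4 * (∫ x, h x * lap ψ φ u x ∂(mu ψ φ)) -
          4 * ∫ x, lap ψ φ u x ^ 2 ∂(mu ψ φ)) + δ) :=
        ENNReal.ofReal_le_ofReal (by linarith)
    _ ≤ ENNReal.ofReal (-4 * (∫ x, h x * lap ψ φ u x ∂(mu ψ φ)) -
          4 * ∫ x, lap ψ φ u x ^ 2 ∂(mu ψ φ)) + ENNReal.ofReal δ := ENNReal.ofReal_add_le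
    _ ≤ ∫⁻ x, Q ψ x (gradient f x) ∂(nu ψ φ) + δ := by
        rw [ENNReal.ofReal_coe_nnreal]
        gcongr

end Poincare

end ToricPoincare

theorem proposition3p6 {n : ℕ} (K : Set (EuclideanSpace ℝ (Fin n)))
    (hKopen : IsOpen K) (hKbdd : Bornology.IsBounded K) (hKconv : Convex ℝ K)
    (ψ φ : EuclideanSpace ℝ (Fin n) → ℝ)
    (hψ : ContDiff ℝ ∞ ψ) (hφ : ContDiff ℝ ∞ φ)
    (hψconv : ConvexOn ℝ Set.univ ψ)
    (hdet : ∀ x, 0 < (ToricPoincare.hess ψ x).det)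
    (hφbdd : BddBelow (Set.range φ))
    (hrange : Set.range (gradient ψ) = K)
    (hstar : ToricPoincare.StarCondition ψ φ)
    (hreg : ToricPoincare.RegularAtInfinity K ψ φ) :
    IsFiniteMeasure (ToricPoincare.nu ψ φ) ∧ ToricPoincare.nu ψ φ Kᶜ = 0 ∧
      ∀ f : EuclideanSpace ℝ (Fin n) → ℝ, (∃ C : ℝ≥0, LipschitzOnWith C f K) →
        ∫ x in K, f x ∂(ToricPoincare.nu ψ φ) = 0 →
          ∫⁻ x in K, ENNReal.ofReal (f x ^ 2) ∂(ToricPoincare.nu ψ φ) ≤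
            ∫⁻ x in K, ToricPoincare.Q ψ x (gradient f x) ∂(ToricPoincare.nu ψ φ) := by
  have hfin := ToricPoincare.isFiniteMeasure_mu hKbdd hψ hψconv hdet hφbdd hrange
  exact ⟨Measure.isFiniteMeasure_map _ _, ToricPoincare.nu_compl hKopen hψ hrange,
    fun f ⟨_, hf⟩ hf0 => ToricPoincare.lintegral_sq_le_lintegral_Q hKopen hKbdd hψ hφ hψconv hdet
      hφbdd hrange hstar hreg hf hf0⟩
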